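/- All vector spaces are $\mathbb Z_2$-graded vector spaces over a field $k$, subspaces and subalgebras are graded, and $\tilde x\in\mathbb Z_2$ denotes the parity of a homogeneous element $x$; $\Pi$ is the parity reversal functor, so that $\Pi x$ has parity $\tilde x+1$. A Lie superalgebra is a vector space with an even bilinear bracket such that, for homogeneous elements, $[x,y]=-(-1)^{\tilde x\tilde y}[y,x]$ and $[x,[y,z]]=[[x,y],z]+(-1)^{\tilde x\tilde y}[y,[x,z]]$. An $L_\infty$-algebra is a vector space $W$ with odd $n$-linear operations $\{w_1,\dots,w_n\}$, $n=0,1,2,\dots$, that are symmetric in the $\mathbb Z_2$-graded sense and for which, for all $n\ge 0$ and all homogeneous $w_1,\dots,w_n\in W$, the $n$-th Jacobiator $$J^n(w_1,\dots,w_n)=\sum_{k+l=n}\ \sum_{(k,l)\text{-shuffles }\sigma}(-1)^{\varepsilon}\{\{w_{\sigma(1)},\dots,w_{\sigma(k)}\},w_{\sigma(k+1)},\dots,w_{\sigma(n)}\}$$ vanishes, where $(-1)^\varepsilon$ is the sign of the rearrangement of $w_1\cdots w_n$ into $w_{\sigma(1)}\cdots w_{\sigma(n)}$ as graded-commuting variables.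 **Theorem.** Let $L$ be a Lie superalgebra that is the direct sum $L=K\oplus V$ of two subalgebras, with $V$ Abelian, and let $P\colon L\to V$ be the projector onto $V$ along $K$. Let $D\colon L\to L$ be an odd derivation, i.e. an odd linear map with $D[x,y]=[Dx,y]+(-1)^{\tilde x}[x,Dy]$, such that $D(K)\subset K$ and $D^2=0$. Then there is exactly one system of graded symmetric multilinear brackets on $\Pi L\oplus V$ such that * the $0$-ary bracket is zero, and the unary bracket is $d(\Pi x,a)=(-\Pi Dx,\;P(x+Da))$ for $x\in L$, $a\in V$; * $\{\Pi x,\Pi y\}=(-1)^{\tilde x}\,\Pi[x,y]$ for $x,y\in L$, $x$ homogeneous; * $\{\Pi x,a_1,\dots,a_n\}=P[\dots[[x,a_1],a_2],\dots,a_n]$ for $x\in L$, $a_i\in V$, $n\ge1$; * $\{a_1,\dots,a_n\}=P[\dots[[Da_1,a_2],a_3],\dots,a_n]$ for $a_i\in V$, $n\ge1$; * every bracket with three or more arguments, at least two of which lie in $\Pi L$, is zero; and with these brackets $\Pi L\oplus V$ is an $L_\infty$-algebra. -/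

import Mathlib

/-- A Lie superalgebra over `k` on the vector space `L`: a `ℤ/2`-grading of `L` and an even bilinear
bracket which is antisymmetric and satisfies the Jacobi identity in the `ℤ/2`-graded sense. The
identities are imposed on homogeneous elements; `(-1 : ℤˣ) ^ i` is the sign `(-1)^i` for the
parity `i : ZMod 2`. -/
structure LieSuperalgebra (k L : Type*) [Field k] [AddCommGroup L] [Module k L] where
  /-- `deg 0` is the even part and `deg 1` the odd part of `L`. -/
  deg : ZMod 2 → Submodule k L
  isInternal : DirectSum.IsInternal deg
  bracket : L →ₗ[k] L →ₗ[k] L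
  bracket_mem : ∀ i j x y, x ∈ deg i → y ∈ deg j → bracket x y ∈ deg (i + j)
  skew : ∀ i j x y, x ∈ deg i → y ∈ deg j →
    bracket x y = -((-1 : ℤˣ) ^ (i * j) • bracket y x)
  jacobi : ∀ i j x y z, x ∈ deg i → y ∈ deg j →
    bracket x (bracket y z) =
      bracket (bracket x y) z + (-1 : ℤˣ) ^ (i * j) • bracket y (bracket x z)

/-- `U` is a graded subspace: every element of `U` is a sum of homogeneous elements of `U`. -/
def IsGradedSubspace {k W : Type*} [Field k] [AddCommGroup W] [Module k W]
    (deg : ZMod 2 → Submodule k W) (U : Submodule k W) : Prop :=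
  U ≤ ⨆ i, U ⊓ deg i

namespace LieSuperalgebra

variable {k L : Type*} [Field k] [AddCommGroup L] [Module k L] (A : LieSuperalgebra k L)

/-- `U` is a (graded) Lie subsuperalgebra. -/
structure IsSubalgebra (U : Submodule k L) : Prop where
  graded : IsGradedSubspace A.deg U
  bracket_mem : ∀ x ∈ U, ∀ y ∈ U, A.bracket x y ∈ U

/-- `U` is an Abelian (graded) Lie subsuperalgebra. -/
structure IsAbelianSubalgebra (U : Submodule k L) : Prop extends A.IsSubalgebra U where
  bracket_eq_zero : ∀ x ∈ U, ∀ y ∈ U, A.bracket x y = 0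

/-- `D` is an odd derivation of the Lie superalgebra. -/
structure IsOddDerivation (D : L →ₗ[k] L) : Prop where
  odd : ∀ i x, x ∈ A.deg i → D x ∈ A.deg (i + 1)
  leibniz : ∀ i x y, x ∈ A.deg i →
    D (A.bracket x y) = A.bracket (D x) y + (-1 : ℤˣ) ^ i • A.bracket x (D y)

/-- The iterated bracket `[…[[x, a₁], a₂], …, aₙ]`, equal to `x` for `n = 0`. -/
def iterBracket : (n : ℕ) → L → (Fin n → L) → L
  | 0, x, _ => x
  | n + 1, x, a => iterBracket n (A.bracket x (a 0)) (Fin.tail a)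

end LieSuperalgebra

/-- The sign `(-1)^ε` arising when the product of homogeneous elements `a₁ ⋯ aₙ` of parities
`p₁, …, pₙ` is rearranged as `a_{σ(1)} ⋯ a_{σ(n)}` : a factor `(-1)^{p_{σ(i)} p_{σ(j)}}` for every
inversion `i < j`, `σ(j) < σ(i)`. -/
def koszulSign {n : ℕ} (σ : Equiv.Perm (Fin n)) (p : Fin n → ZMod 2) : ℤˣ :=
  ∏ i : Fin n, ∏ j : Fin n,
    if i < j ∧ σ j < σ i then (-1 : ℤˣ) ^ (p (σ i) * p (σ j)) else 1

/-- `σ` is a `(k, n - k)`-shuffle: it is increasing on the first `k` and on the last `n - k`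
positions. -/
def IsShuffle {n : ℕ} (k : ℕ) (σ : Equiv.Perm (Fin n)) : Prop :=
  ∀ i j : Fin n, i < j → ((j : ℕ) < k ∨ k ≤ (i : ℕ)) → σ i < σ j

section Brackets

variable {k W : Type*} [Field k] [AddCommGroup W] [Module k W]

/-- The family of multilinear operations `B` (`B n` has `n` arguments) is symmetric in the
`ℤ/2`-graded sense. -/
def IsGradedSymmetric (deg : ZMod 2 → Submodule k W)
    (B : (n : ℕ) → MultilinearMap k (fun _ : Fin n => W) W) : Prop :=
  ∀ (n : ℕ) (p : Fin n → ZMod 2) (a : Fin n → W), (∀ i, a i ∈ deg (p i)) →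
    ∀ σ : Equiv.Perm (Fin n), B n (fun i => a (σ i)) = koszulSign σ p • B n a

open scoped Classical in
/-- The `n`-th Jacobiator on homogeneous arguments `a₁, …, aₙ` of parities `p₁, …, pₙ`:
the sum over `k + l = n` and over the `(k,l)`-shuffles `σ` of
`± {{a_{σ(1)}, …, a_{σ(k)}}, a_{σ(k+1)}, …, a_{σ(n)}}`. -/
noncomputable def jacobiator (B : (n : ℕ) → MultilinearMap k (fun _ : Fin n => W) W) (n : ℕ)
    (p : Fin n → ZMod 2) (a : Fin n → W) : W :=
  ∑ m : Fin (n + 1), ∑ σ : Equiv.Perm (Fin n) with IsShuffle (m : ℕ) σ,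
    koszulSign σ p •
      B (n - m + 1) (Fin.cons
        (B m fun i => a (σ ⟨i, by omega⟩))
        (fun j : Fin (n - m) => a (σ ⟨m + j, by omega⟩)))

/-- The operations `B n`, `n = 0, 1, 2, …`, make the `ℤ/2`-graded vector space `W` an
`L_∞`-algebra: they are odd and symmetric, and all Jacobiators vanish. -/
structure IsLInfinityAlgebra (deg : ZMod 2 → Submodule k W)
    (B : (n : ℕ) → MultilinearMap k (fun _ : Fin n => W) W) : Prop where
  isInternal : DirectSum.IsInternal deg
  odd : ∀ (n : ℕ) (p : Fin n → ZMod 2) (a : Fin n → W), (∀ i, a i ∈ deg (p i)) →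
    B n a ∈ deg ((∑ i, p i) + 1)
  symm : IsGradedSymmetric deg B
  jacobi : ∀ (n : ℕ) (p : Fin n → ZMod 2) (a : Fin n → W), (∀ i, a i ∈ deg (p i)) →
    jacobiator B n p a = 0

end Brackets

namespace LieSuperalgebra

variable {k L : Type*} [Field k] [AddCommGroup L] [Module k L] (A : LieSuperalgebra k L)

/-- The grading of `ΠL ⊕ V`. The underlying space is `L × V`, where the pair `(x, a)` stands for
`(Πx, a)`; the parity of `Πx` is opposite to that of `x`. -/
def coneDeg (V : Submodule k L) (i : ZMod 2) : Submodule k (L × V) :=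
  (A.deg (i + 1)).prod ((A.deg i).comap V.subtype)

/-- `B` is the system of brackets on `ΠL ⊕ V` given by the differential
`d(Πx, a) = (-ΠDx, P(x + Da))`, by `{Πx, Πy} = (-1)^{x̃} Π[x, y]`, by
`{Πx, a₁, …, aₙ} = P[…[x, a₁], …, aₙ]` and `{a₁, …, aₙ} = P[…[Da₁, a₂], …, aₙ]` (`n ≥ 1`),
by (graded) symmetry, and by the vanishing of all the other brackets, namely of the `0`-ary one and
of those with three or more arguments at least two of which lie in `ΠL`. Here `P` is the projector
onto `V` along `K`. -/
structure IsConeBrackets {K V : Submodule k L} (hVK : IsCompl V K) (D : L →ₗ[k] L)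
    (B : (n : ℕ) → MultilinearMap k (fun _ : Fin n => L × V) (L × V)) : Prop where
  symm : IsGradedSymmetric (A.coneDeg V) B
  nullary : B 0 = 0
  unary : ∀ (x : L) (a : V),
    B 1 ![(x, a)] = (-D x, V.projectionOnto K hVK (x + D a))
  binary : ∀ (i : ZMod 2) (x y : L), x ∈ A.deg i →
    B 2 ![(x, 0), (y, 0)] = ((-1 : ℤˣ) ^ i • A.bracket x y, 0)
  mixed : ∀ (n : ℕ) (x : L) (a : Fin n → V), 1 ≤ n →
    B (n + 1) (Fin.cons (x, 0) fun i => (0, a i)) =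
      (0, V.projectionOnto K hVK (A.iterBracket n x fun i => (a i : L)))
  derived : ∀ (n : ℕ) (a : Fin (n + 1) → V),
    B (n + 1) (fun i => (0, a i)) =
      (0, V.projectionOnto K hVK
        (A.iterBracket n (D (a 0)) fun i => (a i.succ : L)))
  others : ∀ (n : ℕ) (u : Fin n → L × V) (i j : Fin n), 3 ≤ n → i ≠ j →
    (u i).2 = 0 → (u j).2 = 0 → B n u = 0

end LieSuperalgebra

/-! Three facts carry the Jacobi identities. Since K is a subalgebra and V is Abelian, P[x,y] =
P[Px,y] + P[x,Py] (`projectionOnto_bracket`). Since D preserves K, PDP = PD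
(`projectionOnto_map_projectionOnto`). Since [a,b] = 0 in V, successive brackets with elements of V
commute up to sign. Expand […[[x,y],a₁],…,aₙ], or D[…[x,a₁],…,aₙ], by the Leibniz rule as a sum over
splittings of the aᵢ into two parts, and apply P. The outcome is a quadratic identity between
projected iterated brackets (`projectionOnto_iterAd_bracket`, `splitSum_projectionOnto_derivation`);
taking x = Da and using D² = 0 gives a third one (`splitSum_projectionOnto_derivedAd`).

These are the V-components of the Jacobiators with two, one and no arguments from ΠL. The
L-components matter only in low arity, where they are the Leibniz rule, D² = 0 and, for three
arguments from ΠL, the Jacobi identity of L. With three arguments from ΠL and at least one more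
argument, every term vanishes. Since the Jacobiator is graded symmetric and additive in each
argument, these cases suffice.

The signs are handled by treating brackets as functions on lists of homogeneous letters: the sum
over shuffles becomes the recursively defined `splitSum` (`sum_shuffles_eq_splitSum`), so every
identity is proved by induction on a list and a finite check of parities. Existence comes from the
closed formula `coneBracket`. Uniqueness holds because homogeneous elements of the two summands
span, and graded symmetry moves a single argument from ΠL to the front. -/

/-! ### Koszul signs of permutations. -/

section Sign

/-- For symmetric `g` both products run over unordered pairs, which τ permutes; (min, max) picks the
ordered representative of the image pair. -/
theorem prod_pairs_comp_perm {M : Type*} [CommMonoid M] {n : ℕ} (τ : Equiv.Perm (Fin n))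
    (g : Fin n → Fin n → M) (hg : ∀ i j, g i j = g j i) :
    (∏ i, ∏ j, if i < j then g (τ i) (τ j) else 1) = ∏ i, ∏ j, if i < j then g i j else 1 := by
  simp only [← Fintype.prod_prod_type']
  rw [← Finset.prod_filter, ← Finset.prod_filter]
  refine Finset.prod_nbij' (fun x => (min (τ x.1) (τ x.2), max (τ x.1) (τ x.2)))
    (fun x => (min (τ.symm x.1) (τ.symm x.2), max (τ.symm x.1) (τ.symm x.2))) ?_ ?_ ?_ ?_ ?_
  · rintro ⟨i, j⟩ h
    simp only [Finset.mem_filter, Finset.mem_univ, true_and, min_lt_max] at h ⊢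
    exact fun e => h.ne (τ.injective e)
  · rintro ⟨i, j⟩ h
    simp only [Finset.mem_filter, Finset.mem_univ, true_and, min_lt_max] at h ⊢
    exact fun e => h.ne (τ.symm.injective e)
  · rintro ⟨i, j⟩ h
    simp only [Finset.mem_filter, Finset.mem_univ, true_and] at h
    rcases le_total (τ i) (τ j) with h' | h' <;> simp [h', h.le]
  · rintro ⟨i, j⟩ h
    simp only [Finset.mem_filter, Finset.mem_univ, true_and] at h
    rcases le_total (τ.symm i) (τ.symm j) with h' | h' <;> simp [h', h.le]
  · rintro ⟨i, j⟩ h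
    rcases le_total (τ i) (τ j) with h' | h' <;> simp [h', hg (τ i)]

/-- A pair is inverted by σ ∘ τ exactly when one, and only one, of these happens: τ inverts it, or σ
inverts its image under τ. If both happen, the two equal signs cancel. -/
theorem koszulSign_mul {n : ℕ} (σ τ : Equiv.Perm (Fin n)) (p : Fin n → ZMod 2) :
    koszulSign (σ * τ) p = koszulSign σ p * koszulSign τ (p ∘ σ) := by
  let g : Fin n → Fin n → ℤˣ := fun x y =>
    if (x < y ∧ σ y < σ x) ∨ (y < x ∧ σ x < σ y) then (-1 : ℤˣ) ^ (p (σ x) * p (σ y)) else 1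
  have hg : ∀ i j, g i j = g j i := fun i j => by
    simp only [g, or_comm, mul_comm (p (σ i))]
  have h : koszulSign σ p = ∏ i, ∏ j, if i < j then g (τ i) (τ j) else 1 := by
    rw [prod_pairs_comp_perm τ g hg]
    refine Finset.prod_congr rfl fun i _ => Finset.prod_congr rfl fun j _ => ?_
    by_cases hij : i < j
    · simp [g, hij, hij.not_gt]
    · simp [hij]
  rw [h]
  simp only [koszulSign, ← Finset.prod_mul_distrib]
  refine Finset.prod_congr rfl fun i _ => Finset.prod_congr rfl fun j _ => ?_
  by_cases hij : i < j
  swap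
  · simp [hij]
  have hne : τ i ≠ τ j := fun e => hij.ne (τ.injective e)
  have hne' : σ (τ i) ≠ σ (τ j) := fun e => hne (σ.injective e)
  rcases lt_or_gt_of_ne hne with h1 | h1 <;> rcases lt_or_gt_of_ne hne' with h2 | h2 <;>
    simp [g, hij, h1, h1.not_gt, h2, h2.not_gt, Int.units_mul_self]

theorem koszulSign_one {n : ℕ} (p : Fin n → ZMod 2) : koszulSign 1 p = 1 := by
  refine Finset.prod_eq_one fun i _ => Finset.prod_eq_one fun j _ => if_neg ?_
  rintro ⟨h, h'⟩
  exact h.not_gt h'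

theorem koszulSign_swap_castSucc_succ {n : ℕ} (i : Fin n) (p : Fin (n + 1) → ZMod 2) :
    koszulSign (Equiv.swap i.castSucc i.succ) p = (-1 : ℤˣ) ^ (p i.castSucc * p i.succ) := by
  have key : ∀ x y : Fin (n + 1), x < y →
      Equiv.swap i.castSucc i.succ y < Equiv.swap i.castSucc i.succ x →
      x = i.castSucc ∧ y = i.succ := by
    intro x y h h'
    simp only [Equiv.swap_apply_def, Fin.ext_iff, Fin.lt_def, Fin.val_castSucc, Fin.val_succ] at *
    split_ifs at h' <;> simp_all <;> omega
  unfold koszulSign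
  rw [Finset.prod_eq_single i.castSucc, Finset.prod_eq_single i.succ]
  · simp [mul_comm]
  · exact fun y _ hy => if_neg fun h => hy (key _ _ h.1 h.2).2
  · simp
  · exact fun x _ hx => Finset.prod_eq_one fun y _ => if_neg fun h => hx (key _ _ h.1 h.2).1
  · simp

end Sign

/-! ### Signed sums over splittings of a list. -/

section SplitSum

variable {α M N : Type*} [AddCommGroup M] [AddCommGroup N]

/-- The parity of a list of letters. -/
def listParity (par : α → ZMod 2) (l : List α) : ZMod 2 := (l.map par).sum

@[simp] theorem listParity_nil (par : α → ZMod 2) : listParity par [] = 0 := rfl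

@[simp] theorem listParity_cons (par : α → ZMod 2) (a : α) (l : List α) :
    listParity par (a :: l) = par a + listParity par l := by simp [listParity]

@[simp] theorem listParity_append (par : α → ZMod 2) (l l' : List α) :
    listParity par (l ++ l') = listParity par l + listParity par l' := by simp [listParity]

/-- The sum of `± f S T` over all ways to split a list into two complementary sublists `S` and `T`,
the sign being that of the rearrangement of the letters into `S ++ T`. -/
def splitSum (par : α → ZMod 2) : (List α → List α → M) → List α → M
  | f, [] => f [] []
  | f, a :: l => splitSum par
      (fun S T => f (a :: S) T + (-1 : ℤˣ) ^ (par a * listParity par S) • f S (a :: T)) l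

variable (par : α → ZMod 2)

@[simp] theorem splitSum_nil (f : List α → List α → M) : splitSum par f [] = f [] [] := rfl

theorem splitSum_cons' (f : List α → List α → M) (a : α) (l : List α) :
    splitSum par f (a :: l) = splitSum par
      (fun S T => f (a :: S) T + (-1 : ℤˣ) ^ (par a * listParity par S) • f S (a :: T)) l := rfl

theorem splitSum_congr {f g : List α → List α → M} (l : List α)
    (h : ∀ S T, (S ++ T).Perm l → f S T = g S T) : splitSum par f l = splitSum par g l := by
  induction l generalizing f g with
  | nil => exact h _ _ (by simp)
  | cons a l ih =>
    refine ih fun S T hST => ?_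
    rw [h (a :: S) T (by simpa using hST), h S (a :: T) (List.perm_middle.trans (hST.cons a))]

theorem splitSum_add (f g : List α → List α → M) (l : List α) :
    splitSum par (fun S T => f S T + g S T) l = splitSum par f l + splitSum par g l := by
  induction l generalizing f g with
  | nil => rfl
  | cons a l ih =>
    simp only [splitSum_cons', ← ih]
    congr 1
    funext S T
    rw [smul_add]
    abel

theorem splitSum_map (φ : M →+ N) (f : List α → List α → M) (l : List α) :
    splitSum par (fun S T => φ (f S T)) l = φ (splitSum par f l) := by
  induction l generalizing f with
  | nil => rfl
  | cons a l ih =>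
    simp only [splitSum_cons', ← ih]
    congr 1
    funext S T
    simp [Units.smul_def]

theorem splitSum_zero (l : List α) : splitSum par (fun _ _ => (0 : M)) l = 0 := by
  simpa using splitSum_map par (0 : M →+ M) (fun _ _ => 0) l

theorem splitSum_smul (c : ℤˣ) (f : List α → List α → M) (l : List α) :
    splitSum par (fun S T => c • f S T) l = c • splitSum par f l :=
  splitSum_map par (DistribSMul.toAddMonoidHom M c) f l

theorem splitSum_neg (f : List α → List α → M) (l : List α) :
    splitSum par (fun S T => -f S T) l = -splitSum par f l :=
  splitSum_map par (negAddMonoidHom : M →+ M) f l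

theorem splitSum_sub (f g : List α → List α → M) (l : List α) :
    splitSum par (fun S T => f S T - g S T) l = splitSum par f l - splitSum par g l := by
  simp only [sub_eq_add_neg, splitSum_add, splitSum_neg]

theorem splitSum_cons (f : List α → List α → M) (a : α) (l : List α) :
    splitSum par f (a :: l) = splitSum par (fun S T => f (a :: S) T) l +
      splitSum par (fun S T => (-1 : ℤˣ) ^ (par a * listParity par S) • f S (a :: T)) l := by
  rw [splitSum_cons', splitSum_add]

/-- Only the splitting with empty first part contributes. -/
theorem splitSum_nil_left (f : List α → List α → M) (h : ∀ a S T, f (a :: S) T = 0)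
    (l : List α) : splitSum par f l = f [] l := by
  induction l generalizing f with
  | nil => rfl
  | cons a l ih =>
    rw [splitSum_cons']
    simp only [h, zero_add]
    rw [ih _ (by simp [h])]
    simp

/-- Only the splitting with empty second part contributes. -/
theorem splitSum_nil_right (f : List α → List α → M) (h : ∀ a S T, f S (a :: T) = 0)
    (l : List α) : splitSum par f l = f l [] := by
  induction l generalizing f with
  | nil => rfl
  | cons a l ih =>
    rw [splitSum_cons']
    simp only [h, smul_zero, add_zero]
    rw [ih _ (by simp [h])]

/-- Exchanging the two parts is a bijection on splittings, and the arrangements S ++ T and T ++ S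
differ by the sign of moving S past T. -/
theorem splitSum_swap (f : List α → List α → M) (l : List α) :
    splitSum par (fun S T => (-1 : ℤˣ) ^ (listParity par S * listParity par T) • f T S) l =
      splitSum par f l := by
  induction l generalizing f with
  | nil => simp
  | cons a l ih =>
    simp only [splitSum_cons']
    rw [← ih (fun S T => f (a :: S) T + (-1 : ℤˣ) ^ (par a * listParity par S) • f S (a :: T))]
    congr 1
    funext S T
    simp only [smul_add, smul_smul, ← uzpow_add, listParity_cons]
    rw [add_comm]
    congr 3
    · generalize listParity par S = s
      generalize listParity par T = t
      generalize par a = b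
      revert s t b; decide
    · ring

/-- A function on lists is graded symmetric if it changes by the Koszul sign under exchanges of
neighbours. -/
def SwapSymm (f : List α → M) : Prop :=
  ∀ (S T : List α) (a b : α), f (S ++ a :: b :: T) = (-1 : ℤˣ) ^ (par a * par b) •
    f (S ++ b :: a :: T)

variable {par}

theorem SwapSymm.cons {f : List α → M} (h : SwapSymm par f) (c : α) :
    SwapSymm par (fun l => f (c :: l)) :=
  fun S T a b => h (c :: S) T a b

theorem SwapSymm.add {f g : List α → M} (hf : SwapSymm par f) (hg : SwapSymm par g) :
    SwapSymm par (fun l => f l + g l) := fun S T a b => by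
  simp only [hf S T a b, hg S T a b, smul_add]

theorem SwapSymm.map {f : List α → M} (hf : SwapSymm par f) (φ : M →+ N) :
    SwapSymm par (fun l => φ (f l)) := fun S T a b => by
  simp only [hf S T a b, Units.smul_def, map_zsmul]

theorem SwapSymm.parity_smul {f : List α → M} (hf : SwapSymm par f) (p : ZMod 2) :
    SwapSymm par (fun l => (-1 : ℤˣ) ^ (p * listParity par l) • f l) := fun S T a b => by
  simp only [hf S T a b, smul_smul, listParity_append, listParity_cons]
  rw [mul_comm, add_left_comm (par a)]

/-- For two leading letters: if both go to the same part, the symmetry of `f` applies; if they are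
separated, the two terms are interchanged, and the signs built into `splitSum` differ by the
required factor. A letter in front of them only replaces `f` by another function symmetric in both
parts. -/
theorem SwapSymm.splitSum {f : List α → List α → M} (hS : ∀ T, SwapSymm par fun S => f S T)
    (hT : ∀ S, SwapSymm par fun T => f S T) : SwapSymm par (splitSum par f) := by
  intro S
  induction S generalizing f with
  | nil =>
    intro T a b
    have h1 : ∀ S T, f (a :: b :: S) T = (-1 : ℤˣ) ^ (par a * par b) • f (b :: a :: S) T :=
      fun S T => hS T [] S a b
    have h2 : ∀ S T, f S (a :: b :: T) = (-1 : ℤˣ) ^ (par a * par b) • f S (b :: a :: T) :=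
      fun S T => hT S [] T a b
    simp only [List.nil_append, splitSum_cons', ← splitSum_smul]
    congr 1
    funext S' T'
    simp only [h1, h2, smul_add, smul_smul, ← uzpow_add, listParity_cons]
    conv_rhs => rw [add_add_add_comm]
    congr 3 <;> congr 1 <;>
    · generalize listParity par S' = s
      generalize par a = x
      generalize par b = y
      revert s x y; decide
  | cons c S ih =>
    intro T a b
    simp only [List.cons_append, splitSum_cons']
    refine ih (fun T' => ?_) (fun S' => ?_) T a b
    · exact ((hS T').cons c).add ((hS (c :: T')).parity_smul (par c))
    · exact (hT (c :: S')).add (((hT S').cons c).map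
        (DistribSMul.toAddMonoidHom M ((-1 : ℤˣ) ^ (par c * listParity par S'))))

theorem SwapSymm.eq_zero_iff_of_perm {f : List α → M} (h : SwapSymm par f) {l l' : List α}
    (hl : l.Perm l') : f l = 0 ↔ f l' = 0 := by
  -- The prefix lets the induction on permutations pass under a common head.
  suffices ∀ S, f (S ++ l) = 0 ↔ f (S ++ l') = 0 from this []
  induction hl with
  | nil => simp
  | cons a _ ih =>
    intro S
    simpa using ih (S ++ [a])
  | swap a b l =>
    intro S
    rw [h S l b a, smul_eq_zero_iff_eq]
  | trans _ _ ih ih' => exact fun S => (ih S).trans (ih' S)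

end SplitSum

/-! ### Shuffles as selections of letters. -/

section Shuffles

variable {α M : Type*} [AddCommGroup M]

/-- The sign of the rearrangement which moves the letters selected by `χ` to the front. -/
def selectionSign {n : ℕ} (χ : Fin n → Bool) (p : Fin n → ZMod 2) : ℤˣ :=
  ∏ x, ∏ y, if χ x = true ∧ χ y = false ∧ y < x then (-1 : ℤˣ) ^ (p x * p y) else 1

theorem selectionSign_cons_true {n : ℕ} (χ : Fin n → Bool) (p : Fin (n + 1) → ZMod 2) :
    selectionSign (Fin.cons true χ : Fin (n + 1) → Bool) p =
      selectionSign χ (fun i => p i.succ) := by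
  simp [selectionSign, Fin.prod_univ_succ]

theorem prod_negOnePow_eq {n : ℕ} (χ : Fin n → Bool) (p : Fin n → ZMod 2) (q : ZMod 2) :
    (∏ x, if χ x = true then (-1 : ℤˣ) ^ (p x * q) else 1) =
      (-1 : ℤˣ) ^ (q * listParity p ((List.finRange n).filter χ)) := by
  induction n with
  | zero => simp
  | succ n ih =>
    rw [Fin.prod_univ_succ, ih (fun i => χ i.succ) (fun i => p i.succ), List.finRange_succ,
      List.filter_cons, List.filter_map]
    have h : listParity p (List.map Fin.succ
        (List.filter (χ ∘ Fin.succ) (List.finRange n))) =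
        listParity (fun i => p i.succ) (List.filter (fun i => χ i.succ) (List.finRange n)) := by
      simp [listParity, Function.comp_def]
    by_cases h0 : χ 0 = true
    · simp [h0, h, add_mul, uzpow_add, mul_comm q]
    · simp [h0, h]

theorem selectionSign_cons_false {n : ℕ} (χ : Fin n → Bool) (p : Fin (n + 1) → ZMod 2) :
    selectionSign (Fin.cons false χ : Fin (n + 1) → Bool) p =
      (-1 : ℤˣ) ^ (p 0 * listParity (fun i => p i.succ) ((List.finRange n).filter χ)) *
      selectionSign χ (fun i => p i.succ) := by
  rw [← prod_negOnePow_eq]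
  simp only [selectionSign, ← Finset.prod_mul_distrib]
  rw [Fin.prod_univ_succ]
  simp only [Fin.prod_univ_succ (n := n) (M := ℤˣ), Fin.cons_zero, Fin.cons_succ]
  simp

/-- A selection is a choice for the head and a selection from the tail. A head sent to the second
part passes all selected letters, which is the sign in the recursion of `splitSum`. -/
theorem sum_selections_eq_splitSum (par : α → ZMod 2) (F : List α → List α → M) {n : ℕ}
    (c : Fin n → α) :
    (∑ χ : Fin n → Bool, selectionSign χ (fun i => par (c i)) •
      F (((List.finRange n).filter χ).map c) (((List.finRange n).filter fun i => !χ i).map c)) =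
      splitSum par F (List.ofFn c) := by
  induction n generalizing F with
  | zero => simp [selectionSign]
  | succ n ih =>
    rw [List.ofFn_succ, splitSum_cons', ← ih, ← (Fin.consEquiv fun _ => Bool).sum_comp,
      Fintype.sum_prod_type, Fintype.sum_bool, ← Finset.sum_add_distrib]
    refine Finset.sum_congr rfl fun χ _ => ?_
    simp only [Fin.consEquiv, Equiv.coe_fn_mk, List.finRange_succ, List.filter_cons,
      List.filter_map, Fin.cons_zero, Function.comp_def, Fin.cons_succ]
    simp only [selectionSign_cons_true, selectionSign_cons_false, smul_add, smul_smul]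
    simp [listParity, Function.comp_def, mul_comm]

theorem IsShuffle.strictMono_left {n m : ℕ} {σ : Equiv.Perm (Fin n)} (h : IsShuffle m σ)
    (hm : m ≤ n) : StrictMono fun i : Fin m => σ ⟨i, by omega⟩ :=
  fun _ j hij => h _ _ hij (Or.inl j.2)

theorem IsShuffle.strictMono_right {n m : ℕ} {σ : Equiv.Perm (Fin n)} (h : IsShuffle m σ) :
    StrictMono fun j : Fin (n - m) => σ ⟨m + j, by omega⟩ :=
  fun _ _ hij => h _ _ (Fin.lt_def.2 (Nat.add_lt_add_left hij m)) (Or.inr (Nat.le_add_right _ _))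

theorem eq_filter_finRange {n : ℕ} {l : List (Fin n)} (hl : l.Pairwise (· < ·))
    (χ : Fin n → Bool) (h : ∀ x, x ∈ l ↔ χ x = true) : l = (List.finRange n).filter χ := by
  have h2 : ((List.finRange n).filter χ).Pairwise (· < ·) :=
    (List.pairwise_lt_finRange n).filter _
  refine List.Perm.eq_of_pairwise (le := (· < ·)) (fun a b _ _ hab hba => absurd hab hba.not_gt)
    hl h2 ?_
  rw [List.perm_ext_iff_of_nodup (hl.imp fun h => h.ne) (h2.imp fun h => h.ne)]
  simp [h]

/-- The letters which a shuffle moves to the front. -/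
def shuffleSelection {n : ℕ} (m : ℕ) (σ : Equiv.Perm (Fin n)) (x : Fin n) : Bool :=
  decide ((σ.symm x : ℕ) < m)

theorem IsShuffle.ofFn_left {n m : ℕ} {σ : Equiv.Perm (Fin n)} (h : IsShuffle m σ)
    (hm : m ≤ n) : List.ofFn (fun i : Fin m => σ ⟨i, by omega⟩) =
      (List.finRange n).filter (shuffleSelection m σ) := by
  refine eq_filter_finRange (List.pairwise_ofFn.2 fun i j hij => h.strictMono_left hm hij) _
    fun x => ?_
  simp only [List.mem_ofFn, shuffleSelection, decide_eq_true_eq]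
  constructor
  · rintro ⟨i, rfl⟩
    simp
  · exact fun hx => ⟨⟨σ.symm x, hx⟩, by simp⟩

theorem IsShuffle.ofFn_right {n m : ℕ} {σ : Equiv.Perm (Fin n)} (h : IsShuffle m σ) :
    List.ofFn (fun j : Fin (n - m) => σ ⟨m + j, by omega⟩) =
      (List.finRange n).filter (fun x => !shuffleSelection m σ x) := by
  refine eq_filter_finRange (List.pairwise_ofFn.2 fun i j hij => h.strictMono_right hij) _
    fun x => ?_
  simp only [List.mem_ofFn, shuffleSelection, Bool.not_eq_true', decide_eq_false_iff_not, not_lt]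
  constructor
  · rintro ⟨i, rfl⟩
    simp
  · exact fun hx => ⟨⟨σ.symm x - m, by omega⟩, by simp [Nat.add_sub_cancel' hx]⟩

/-- A shuffle is increasing on each block, so an inversion always pairs a position in the first
block with one in the second. -/
theorem IsShuffle.koszulSign_eq {n m : ℕ} {σ : Equiv.Perm (Fin n)} (h : IsShuffle m σ)
    (p : Fin n → ZMod 2) : koszulSign σ p = selectionSign (shuffleSelection m σ) p := by
  unfold selectionSign koszulSign
  refine Fintype.prod_equiv σ _ _ fun i => Fintype.prod_equiv σ _ _ fun j => ?_
  congr 1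
  simp only [shuffleSelection, Equiv.symm_apply_apply, decide_eq_true_eq, decide_eq_false_iff_not,
    not_lt, eq_iff_iff]
  constructor
  · rintro ⟨hij, hji⟩
    refine ⟨?_, ?_, hji⟩ <;> by_contra hc
    · exact hji.not_gt (h i j hij (Or.inr (by omega)))
    · exact hji.not_gt (h i j hij (Or.inl (by omega)))
  · rintro ⟨hi, hj, hji⟩
    exact ⟨Fin.lt_def.2 (by omega), hji⟩

theorem IsShuffle.ext {n m m' : ℕ} {σ σ' : Equiv.Perm (Fin n)} (h : IsShuffle m σ)
    (h' : IsShuffle m' σ') (hm : m ≤ n) (hm' : m' ≤ n)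
    (e : shuffleSelection m σ = shuffleSelection m' σ') : m = m' ∧ σ = σ' := by
  have e1 := (h.ofFn_left hm).trans ((congrArg (fun χ => (List.finRange n).filter χ) e).trans
    (h'.ofFn_left hm').symm)
  have e2 := h.ofFn_right.trans ((congrArg (fun χ : Fin n → Bool =>
    (List.finRange n).filter fun x => !χ x) e).trans h'.ofFn_right.symm)
  have hmm : m = m' := by simpa using congrArg List.length e1
  subst hmm
  refine ⟨rfl, Equiv.ext fun x => ?_⟩
  have e1' := List.ofFn_injective e1
  have e2' := List.ofFn_injective e2
  by_cases hx : (x : ℕ) < m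
  · exact congrFun e1' ⟨x, hx⟩
  · simpa [Nat.add_sub_cancel' (not_lt.1 hx)] using congrFun e2' ⟨x - m, by omega⟩

/-- The shuffle enumerates the selected letters in increasing order, then the remaining ones in
increasing order. -/
theorem exists_shuffle_of_selection {n : ℕ} (χ : Fin n → Bool) :
    ∃ (m : ℕ) (σ : Equiv.Perm (Fin n)), m ≤ n ∧ IsShuffle m σ ∧ shuffleSelection m σ = χ := by
  let s : Finset (Fin n) := Finset.univ.filter fun x => χ x = true
  obtain ⟨m, hm⟩ : ∃ m, s.card = m := ⟨_, rfl⟩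
  have hmn : m ≤ n := hm ▸ (Finset.card_le_univ s).trans (by simp)
  have hn : sᶜ.card = n - m := by rw [Finset.card_compl, hm, Fintype.card_fin]
  let σ : Equiv.Perm (Fin n) := ((finCongr (by omega)).trans
    (finSumFinEquiv (m := m) (n := n - m)).symm).trans (finSumEquivOfFinset hm hn)
  have hl : ∀ (i : Fin n) (hi : (i : ℕ) < m), σ i = s.orderEmbOfFin hm ⟨i, hi⟩ := by
    intro i hi
    have : finSumFinEquiv.symm (finCongr (by omega : n = m + (n - m)) i) = Sum.inl ⟨i, hi⟩ := by
      rw [Equiv.symm_apply_eq]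
      rfl
    simp only [σ, Equiv.trans_apply, this, finSumEquivOfFinset_inl]
  have hr : ∀ (i : Fin n) (hi : m ≤ (i : ℕ)),
      σ i = sᶜ.orderEmbOfFin hn ⟨i - m, by omega⟩ := by
    intro i hi
    have : finSumFinEquiv.symm (finCongr (by omega : n = m + (n - m)) i) =
        Sum.inr ⟨i - m, by omega⟩ := by
      rw [Equiv.symm_apply_eq]
      exact Fin.ext (Nat.add_sub_cancel' hi).symm
    simp only [σ, Equiv.trans_apply, this, finSumEquivOfFinset_inr]
  refine ⟨m, σ, hmn, ?_, ?_⟩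
  · rintro i j hij (h | h)
    · rw [hl i (lt_trans hij h), hl j h]
      exact (s.orderEmbOfFin hm).strictMono hij
    · rw [hr i h, hr j (h.trans (le_of_lt hij))]
      refine (sᶜ.orderEmbOfFin hn).strictMono ?_
      exact Fin.lt_def.2 (Nat.sub_lt_sub_right h hij)
  · funext x
    obtain ⟨i, rfl⟩ := σ.surjective x
    simp only [shuffleSelection, Equiv.symm_apply_apply]
    by_cases hi : (i : ℕ) < m
    · have := s.orderEmbOfFin_mem hm ⟨i, hi⟩
      rw [← hl i hi] at this
      simp only [hi, decide_true]
      exact (Finset.mem_filter.1 this).2.symm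
    · have := sᶜ.orderEmbOfFin_mem hn ⟨i - m, by omega⟩
      rw [← hr i (not_lt.1 hi)] at this
      have h' : ¬χ (σ i) = true := fun h =>
        Finset.mem_compl.1 this (Finset.mem_filter.2 ⟨Finset.mem_univ _, h⟩)
      rw [Bool.eq_false_of_not_eq_true h', decide_eq_false hi]

open scoped Classical in
theorem sum_shuffles_eq_splitSum (par : α → ZMod 2) (F : List α → List α → M) {n : ℕ}
    (c : Fin n → α) :
    (∑ m : Fin (n + 1), ∑ σ : Equiv.Perm (Fin n) with IsShuffle (m : ℕ) σ,
      koszulSign σ (fun i => par (c i)) •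
        F (List.ofFn fun i : Fin m => c (σ ⟨i, by omega⟩))
          (List.ofFn fun j : Fin (n - m) => c (σ ⟨m + j, by omega⟩))) =
      splitSum par F (List.ofFn c) := by
  rw [← sum_selections_eq_splitSum, Finset.sum_sigma']
  refine Finset.sum_nbij (fun x => shuffleSelection (x.1 : ℕ) x.2) (by simp) ?_ ?_ ?_
  · rintro ⟨m, σ⟩ h ⟨m', σ'⟩ h' e
    simp only [Finset.coe_sigma, Set.mem_sigma_iff, Finset.mem_coe, Finset.mem_filter,
      Finset.mem_univ, true_and] at h h'
    obtain ⟨h1, h2⟩ := h.ext h' (by omega) (by omega) e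
    obtain rfl := Fin.ext h1
    rw [h2]
  · intro χ _
    obtain ⟨m, σ, hm, h, e⟩ := exists_shuffle_of_selection χ
    exact ⟨⟨⟨m, by omega⟩, σ⟩, by simpa using h, e⟩
  · rintro ⟨m, σ⟩ h
    simp only [Finset.mem_sigma, Finset.mem_filter, Finset.mem_univ, true_and] at h
    rw [← h.koszulSign_eq, ← h.ofFn_left (by omega), ← h.ofFn_right, List.map_ofFn, List.map_ofFn]
    rfl

end Shuffles

/-! ### Sign rules and two-term gradings. -/

theorem neg_eq_negOnePow_smul {M : Type*} [AddCommGroup M] (x : M) :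
    -x = (-1 : ℤˣ) ^ (1 : ZMod 2) • x := by simp [Units.smul_def]

theorem negOnePow_add_one_smul {M : Type*} [AddCommGroup M] (i : ZMod 2) (x : M) :
    (-1 : ℤˣ) ^ (i + 1) • x = -((-1 : ℤˣ) ^ i • x) := by
  rw [add_comm, uzpow_add, mul_smul, ← neg_eq_negOnePow_smul]

theorem zmod_two_cases (i : ZMod 2) : i = 0 ∨ i = 1 := by revert i; decide

theorem map_units_int_smul {M N : Type*} [AddCommGroup M] [AddCommGroup N] {F : Type*}
    [FunLike F M N] [AddMonoidHomClass F M N] (f : F) (c : ℤˣ) (x : M) : f (c • x) = c • f x := by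
  simp [Units.smul_def]

theorem IsGradedSubspace.exists_add {k W : Type*} [Field k] [AddCommGroup W] [Module k W]
    {deg : ZMod 2 → Submodule k W} {U : Submodule k W} (h : IsGradedSubspace deg U) {x : W}
    (hx : x ∈ U) : ∃ y z, y ∈ U ∧ y ∈ deg 0 ∧ z ∈ U ∧ z ∈ deg 1 ∧ y + z = x := by
  have h' : (⨆ i, U ⊓ deg i) = (U ⊓ deg 0) ⊔ (U ⊓ deg 1) := by
    apply le_antisymm
    · refine iSup_le fun i => ?_
      obtain rfl | rfl := zmod_two_cases i
      · exact le_sup_left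
      · exact le_sup_right
    · exact sup_le (le_iSup (fun i => U ⊓ deg i) 0) (le_iSup (fun i => U ⊓ deg i) 1)
  obtain ⟨y, hy, z, hz, e⟩ := Submodule.mem_sup.1 (h' ▸ h hx)
  exact ⟨y, z, hy.1, hy.2, hz.1, hz.2, e⟩

theorem isInternal_zmod_two_iff {k W : Type*} [Field k] [AddCommGroup W] [Module k W]
    (deg : ZMod 2 → Submodule k W) : DirectSum.IsInternal deg ↔ IsCompl (deg 0) (deg 1) :=
  DirectSum.isInternal_submodule_iff_isCompl deg (i := 0) (j := 1) (by decide)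
    (by ext i; simpa using (zmod_two_cases i))

/-! ### Iterated brackets with elements of V, and derivations. -/

namespace LieSuperalgebra

variable {k L : Type*} [Field k] [AddCommGroup L] [Module k L] (A : LieSuperalgebra k L)

theorem isCompl_deg : IsCompl (A.deg 0) (A.deg 1) := (isInternal_zmod_two_iff _).1 A.isInternal

theorem exists_homogeneous_add (x : L) : ∃ y ∈ A.deg 0, ∃ z ∈ A.deg 1, y + z = x :=
  Submodule.mem_sup.1 (A.isCompl_deg.sup_eq_top ▸ Submodule.mem_top)

theorem homogeneous_induction {motive : L → Prop} (hom : ∀ i, ∀ x ∈ A.deg i, motive x)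
    (add : ∀ x y, motive x → motive y → motive (x + y)) (x : L) : motive x := by
  obtain ⟨y, hy, z, hz, rfl⟩ := A.exists_homogeneous_add x
  exact add _ _ (hom 0 y hy) (hom 1 z hz)

/-- The grading involution, `x ↦ (-1)^i x` for `x` of parity `i`. -/
noncomputable def gradingInvolution : L →ₗ[k] L :=
  LinearMap.ofIsCompl A.isCompl_deg (A.deg 0).subtype (-(A.deg 1).subtype)

theorem gradingInvolution_apply {i : ZMod 2} {x : L} (hx : x ∈ A.deg i) :
    A.gradingInvolution x = (-1 : ℤˣ) ^ i • x := by
  obtain rfl | rfl := zmod_two_cases i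
  · rw [uzpow_zero, one_smul]
    exact LinearMap.ofIsCompl_apply_left A.isCompl_deg ⟨x, hx⟩
  · rw [← neg_eq_negOnePow_smul]
    exact LinearMap.ofIsCompl_apply_right A.isCompl_deg ⟨x, hx⟩

theorem bracket_skew {i j : ZMod 2} {x y : L} (hx : x ∈ A.deg i) (hy : y ∈ A.deg j) :
    A.bracket x y = (-1 : ℤˣ) ^ (i * j + 1) • A.bracket y x := by
  rw [A.skew i j x y hx hy, neg_eq_negOnePow_smul, smul_smul, ← uzpow_add, add_comm]

theorem negOnePow_smul_mem {i : ZMod 2} {x : L} (c : ℤˣ) (hx : x ∈ A.deg i) :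
    c • x ∈ A.deg i := by
  rw [Units.smul_def]
  exact zsmul_mem hx _

/-- The right form of the Jacobi identity. -/
theorem bracket_bracket {i j q : ZMod 2} {x y z : L} (hx : x ∈ A.deg i) (hy : y ∈ A.deg j)
    (hz : z ∈ A.deg q) : A.bracket (A.bracket x y) z =
      A.bracket x (A.bracket y z) + (-1 : ℤˣ) ^ (j * q) • A.bracket (A.bracket x z) y := by
  have e : ∀ i j q : ZMod 2, i * j + (j * (i + q) + 1) = j * q + 1 := by decide
  rw [A.jacobi i j x y z hx hy, A.bracket_skew hy (A.bracket_mem _ _ _ _ hx hz), smul_smul,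
    ← uzpow_add, e, negOnePow_add_one_smul, neg_add_cancel_right]

variable {V : Submodule k L}

/-- Homogeneous elements of `ΠL ⊕ V`, together with their parities. -/
abbrev ConeLetter (V : Submodule k L) : Type _ := Σ p : ZMod 2, A.coneDeg V p

/-- The parity of a homogeneous element of `ΠL ⊕ V`. -/
abbrev coneParity (u : A.ConeLetter V) : ZMod 2 := u.1

/-- The underlying list of elements of `ΠL ⊕ V`. -/
def vals (l : List (A.ConeLetter V)) : List (L × V) := l.map fun u => u.2.1

@[simp] theorem vals_nil : A.vals ([] : List (A.ConeLetter V)) = [] := rfl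

@[simp] theorem vals_cons (u : A.ConeLetter V) (l : List (A.ConeLetter V)) :
    A.vals (u :: l) = u.2.1 :: A.vals l := rfl

@[simp] theorem vals_append (l l' : List (A.ConeLetter V)) :
    A.vals (l ++ l') = A.vals l ++ A.vals l' := List.map_append

variable {A}

theorem ConeLetter.fst_mem (u : A.ConeLetter V) : u.2.1.1 ∈ A.deg (u.1 + 1) := u.2.2.1

theorem ConeLetter.snd_mem (u : A.ConeLetter V) : (u.2.1.2 : L) ∈ A.deg u.1 := u.2.2.2

theorem IsAbelianSubalgebra.bracket_comm (hV : A.IsAbelianSubalgebra V) {p q : ZMod 2} {a b : L}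
    (ha : a ∈ V) (hb : b ∈ V) (hap : a ∈ A.deg p) (hbq : b ∈ A.deg q) (x : L) :
    A.bracket (A.bracket x a) b = (-1 : ℤˣ) ^ (p * q) • A.bracket (A.bracket x b) a := by
  induction x using A.homogeneous_induction with
  | hom i x hx =>
    rw [A.bracket_bracket hx hap hbq, hV.bracket_eq_zero a ha b hb, map_zero, zero_add]
  | add x y hx hy => simp only [map_add, LinearMap.add_apply, hx, hy, smul_add]

theorem IsAbelianSubalgebra.bracket_left_comm (hV : A.IsAbelianSubalgebra V) {p q : ZMod 2}
    {a b : L} (ha : a ∈ V) (hb : b ∈ V) (hap : a ∈ A.deg p) (hbq : b ∈ A.deg q) (x : L) :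
    A.bracket a (A.bracket b x) = (-1 : ℤˣ) ^ (p * q) • A.bracket b (A.bracket a x) := by
  rw [A.jacobi p q a b x hap hbq, hV.bracket_eq_zero a ha b hb, map_zero, LinearMap.zero_apply,
    zero_add]

variable (A) in
/-- The iterated bracket `x ↦ […[[x, a₁], a₂], …, aₙ]` with the `V`-components of the elements of a
list. -/
def iterAd : List (L × V) → L →ₗ[k] L
  | [] => LinearMap.id
  | u :: l => iterAd l ∘ₗ A.bracket.flip u.2

@[simp] theorem iterAd_nil (x : L) : A.iterAd ([] : List (L × V)) x = x := rfl

@[simp] theorem iterAd_cons (u : L × V) (l : List (L × V)) (x : L) :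
    A.iterAd (u :: l) x = A.iterAd l (A.bracket x u.2) := rfl

theorem iterAd_append (l l' : List (L × V)) (x : L) :
    A.iterAd (l ++ l') x = A.iterAd l' (A.iterAd l x) := by
  induction l generalizing x with
  | nil => rfl
  | cons u l ih => simp [ih]

variable (A) in
/-- The iterated bracket `[…[[Da₁, a₂], a₃], …, aₙ]` of the `V`-components of a list. -/
def derivedAd (D : L →ₗ[k] L) : List (L × V) → L
  | [] => 0
  | u :: l => A.iterAd l (D u.2)

@[simp] theorem derivedAd_nil (D : L →ₗ[k] L) : A.derivedAd D ([] : List (L × V)) = 0 := rfl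

@[simp] theorem derivedAd_cons (D : L →ₗ[k] L) (u : L × V) (l : List (L × V)) :
    A.derivedAd D (u :: l) = A.iterAd l (D u.2) := rfl

theorem iterAd_mem {i : ZMod 2} {x : L} (hx : x ∈ A.deg i) (l : List (A.ConeLetter V)) :
    A.iterAd (A.vals l) x ∈ A.deg (i + listParity A.coneParity l) := by
  induction l generalizing x i with
  | nil => simpa using hx
  | cons u l ih =>
    rw [listParity_cons, ← add_assoc]
    exact ih (A.bracket_mem _ _ _ _ hx u.snd_mem)

theorem derivedAd_mem {D : L →ₗ[k] L} (hD : A.IsOddDerivation D) (l : List (A.ConeLetter V)) :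
    A.derivedAd D (A.vals l) ∈ A.deg (listParity A.coneParity l + 1) := by
  cases l with
  | nil => exact zero_mem _
  | cons u l =>
    rw [listParity_cons, add_right_comm]
    exact iterAd_mem (hD.odd _ _ u.snd_mem) l

theorem bracket_iterAd (hV : A.IsAbelianSubalgebra V) {p : ZMod 2} {v : L} (hv : v ∈ V)
    (hvp : v ∈ A.deg p) (l : List (A.ConeLetter V)) (x : L) :
    A.bracket (A.iterAd (A.vals l) x) v =
      (-1 : ℤˣ) ^ (p * listParity A.coneParity l) • A.iterAd (A.vals l) (A.bracket x v) := by
  induction l generalizing x with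
  | nil => simp
  | cons u l ih =>
    simp only [vals_cons, iterAd_cons, ih,
      hV.bracket_comm u.2.1.2.2 hv u.snd_mem hvp x, map_units_int_smul, smul_smul, ← uzpow_add,
      listParity_cons]
    congr 2
    ring

/-- Bracketing on the right with a letter is a derivation, so each letter acts either on `x` or on
`y`. The letters `S` acting on `x` have to pass `y`, hence the extra sign. -/
theorem iterAd_bracket {i j : ZMod 2} {x y : L} (hx : x ∈ A.deg i) (hy : y ∈ A.deg j)
    (l : List (A.ConeLetter V)) :
    A.iterAd (A.vals l) (A.bracket x y) = splitSum A.coneParity (fun S T =>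
      (-1 : ℤˣ) ^ (j * listParity A.coneParity S) •
        A.bracket (A.iterAd (A.vals S) x) (A.iterAd (A.vals T) y)) l := by
  induction l generalizing x y i j with
  | nil => simp
  | cons u l ih =>
    rw [splitSum_cons, vals_cons, iterAd_cons, A.bracket_bracket hx hy u.snd_mem, map_add,
      map_units_int_smul, ih hx (A.bracket_mem _ _ _ _ hy u.snd_mem),
      ih (A.bracket_mem _ _ _ _ hx u.snd_mem) hy, ← splitSum_smul, add_comm]
    congr 2 <;> funext S T <;>
      simp only [smul_smul, ← uzpow_add, listParity_cons, vals_cons, iterAd_cons] <;>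
      congr 2 <;> ring

/-- `D` hits `x` or one letter. If it hits a letter, the earlier letters have already acted on `x`
and the later ones are distributed over the two factors; so the letter hit is the first one of `T`,
which is where `derivedAd` puts `D`. Empty `T` contributes nothing, as `derivedAd` vanishes there.
-/
theorem derivation_iterAd {D : L →ₗ[k] L} (hD : A.IsOddDerivation D) {i : ZMod 2} {x : L}
    (hx : x ∈ A.deg i) (l : List (A.ConeLetter V)) :
    D (A.iterAd (A.vals l) x) = A.iterAd (A.vals l) (D x) +
      (-1 : ℤˣ) ^ i • splitSum A.coneParity (fun S T =>
      (-1 : ℤˣ) ^ (listParity A.coneParity S) •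
        A.bracket (A.iterAd (A.vals S) x) (A.derivedAd D (A.vals T))) l := by
  induction l generalizing x i with
  | nil => simp
  | cons u l ih =>
    rw [splitSum_cons, vals_cons, iterAd_cons, ih (A.bracket_mem _ _ _ _ hx u.snd_mem),
      hD.leibniz i x _ hx, map_add, map_units_int_smul,
      iterAd_bracket hx (hD.odd _ _ u.snd_mem), iterAd_cons, add_assoc, smul_add,
      add_comm ((-1 : ℤˣ) ^ i • splitSum _ _ _)]
    congr 2
    · rw [uzpow_add, mul_smul, ← splitSum_smul]
      congr 2
      funext S T
      simp only [smul_smul, ← uzpow_add, listParity_cons, vals_cons, iterAd_cons]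
    · congr 2
      funext S T
      simp only [smul_smul, ← uzpow_add, vals_cons, derivedAd_cons]
      congr 2
      ring

/-- Apply `D` to [a,b] = 0. -/
theorem IsOddDerivation.bracket_comm {D : L →ₗ[k] L} (hD : A.IsOddDerivation D)
    (hV : A.IsAbelianSubalgebra V) {p q : ZMod 2} {a b : L}
    (ha : a ∈ V) (hb : b ∈ V) (hap : a ∈ A.deg p) (hbq : b ∈ A.deg q) :
    A.bracket (D a) b = (-1 : ℤˣ) ^ (p * q) • A.bracket (D b) a := by
  have h := hD.leibniz p a b hap
  have e : ∀ p q : ZMod 2, p + (p * (q + 1) + 1) = p * q + 1 := by decide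
  rw [hV.bracket_eq_zero a ha b hb, map_zero, A.bracket_skew hap (hD.odd _ _ hbq), smul_smul,
    ← uzpow_add, e, negOnePow_add_one_smul, ← sub_eq_add_neg] at h
  exact sub_eq_zero.1 h.symm

/-- Move `v` into the innermost bracket, then transfer `D` from `u` to `v`. The list must be
nonempty: for the empty one the left side vanishes while the right side is ±Dv. -/
theorem bracket_derivedAd_cons {D : L →ₗ[k] L} (hD : A.IsOddDerivation D)
    (hV : A.IsAbelianSubalgebra V) {p : ZMod 2} {v : L} (hv : v ∈ V) (hvp : v ∈ A.deg p)
    (u : A.ConeLetter V) (l : List (A.ConeLetter V)) :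
    A.bracket v (A.derivedAd D (A.vals (u :: l))) =
      (-1 : ℤˣ) ^ (p + 1) • A.iterAd (A.vals (u :: l)) (D v) := by
  rw [A.bracket_skew hvp (derivedAd_mem hD (u :: l)), vals_cons, derivedAd_cons,
    bracket_iterAd hV hv hvp, iterAd_cons, hD.bracket_comm hV hv u.2.1.2.2 hvp u.snd_mem,
    map_units_int_smul, smul_smul, smul_smul, ← uzpow_add, ← uzpow_add, listParity_cons]
  have e : ∀ p q t : ZMod 2, p * (q + t + 1) + 1 + p * t = p + 1 + p * q := by decide
  rw [e]

end LieSuperalgebra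

theorem map_splitSum {α M N : Type*} [AddCommGroup M] [AddCommGroup N] {F : Type*}
    [FunLike F M N] [AddMonoidHomClass F M N] (φ : F) (par : α → ZMod 2)
    (f : List α → List α → M) (l : List α) :
    φ (splitSum par f l) = splitSum par (fun S T => φ (f S T)) l :=
  (splitSum_map par (φ : M →+ N) f l).symm

/-! ### The projector and the three quadratic identities. -/

namespace LieSuperalgebra

variable {k L : Type*} [Field k] [AddCommGroup L] [Module k L] {A : LieSuperalgebra k L}
  {K V : Submodule k L}

theorem sub_projectionOnto_mem (hVK : IsCompl V K) (x : L) :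
    x - V.projectionOnto K hVK x ∈ K := by
  rw [← Submodule.projectionOnto_apply_eq_zero_iff hVK, map_sub,
    Submodule.projectionOnto_apply_left, sub_self]

/-- The projector is even because both summands are graded: the V- and K-parts of the wrong parity
add up to zero, so each vanishes by V ∩ K = 0. -/
theorem projectionOnto_mem_deg (hK : A.IsSubalgebra K) (hV : A.IsAbelianSubalgebra V)
    (hVK : IsCompl V K) {i : ZMod 2} {x : L} (hx : x ∈ A.deg i) :
    (V.projectionOnto K hVK x : L) ∈ A.deg i := by
  obtain ⟨v₀, v₁, hv₀, hv₀', hv₁, hv₁', hv⟩ :=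
    hV.graded.exists_add (V.projectionOnto K hVK x).2
  obtain ⟨w₀, w₁, hw₀, hw₀', hw₁, hw₁', hw⟩ :=
    hK.graded.exists_add (sub_projectionOnto_mem hVK x)
  have hsum : (v₀ + w₀) + (v₁ + w₁) = x := by
    rw [add_add_add_comm, hv, hw, add_sub_cancel]
  have zero : ∀ v ∈ V, ∀ w ∈ K, v + w = 0 → v = 0 := fun v hv w hw h =>
    Submodule.disjoint_def.1 hVK.disjoint v hv (by
      rw [eq_neg_of_add_eq_zero_left h]
      exact neg_mem hw)
  rw [← hv]
  obtain rfl | rfl := zmod_two_cases i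
  · have h1 : v₁ + w₁ = 0 := Submodule.disjoint_def.1 A.isCompl_deg.disjoint _ (by
      rw [← sub_eq_of_eq_add' hsum.symm]
      exact sub_mem hx (add_mem hv₀' hw₀')) (add_mem hv₁' hw₁')
    rw [zero _ hv₁ _ hw₁ h1, add_zero]
    exact hv₀'
  · have h1 : v₀ + w₀ = 0 := Submodule.disjoint_def.1 A.isCompl_deg.disjoint _
      (add_mem hv₀' hw₀') (by
      rw [← sub_eq_of_eq_add hsum.symm]
      exact sub_mem hx (add_mem hv₁' hw₁'))
    rw [zero _ hv₀ _ hw₀ h1, zero_add]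
    exact hv₁'

/-- Expand P[x − Px, y − Py] = 0, which holds as K is closed under the bracket, and drop [Px, Py] =
0. -/
theorem projectionOnto_bracket (hK : A.IsSubalgebra K) (hV : A.IsAbelianSubalgebra V)
    (hVK : IsCompl V K) (x y : L) :
    V.projectionOnto K hVK (A.bracket x y) =
      V.projectionOnto K hVK (A.bracket (V.projectionOnto K hVK x) y) +
      V.projectionOnto K hVK (A.bracket x (V.projectionOnto K hVK y)) := by
  have h := (Submodule.projectionOnto_apply_eq_zero_iff hVK).2
    (hK.bracket_mem _ (sub_projectionOnto_mem hVK x) _ (sub_projectionOnto_mem hVK y))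
  have h' := hV.bracket_eq_zero _ (V.projectionOnto K hVK x).2 _ (V.projectionOnto K hVK y).2
  simp only [map_sub, LinearMap.sub_apply, h', sub_zero] at h
  rw [sub_sub, sub_eq_zero] at h
  rw [h]

theorem projectionOnto_map_projectionOnto (hVK : IsCompl V K) {D : L →ₗ[k] L}
    (hDK : ∀ x ∈ K, D x ∈ K) (x : L) :
    V.projectionOnto K hVK (D (V.projectionOnto K hVK x)) = V.projectionOnto K hVK (D x) := by
  have h := (Submodule.projectionOnto_apply_eq_zero_iff hVK).2
    (hDK _ (sub_projectionOnto_mem hVK x))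
  rw [map_sub, map_sub, sub_eq_zero] at h
  exact h.symm

/-- Split the bracket by the Leibniz rule and apply `projectionOnto_bracket` to each term. The
projected factor lies in V, so it can be moved inside the iterated bracket of the other factor. -/
theorem projectionOnto_iterAd_bracket (hK : A.IsSubalgebra K) (hV : A.IsAbelianSubalgebra V)
    (hVK : IsCompl V K) {i j : ZMod 2} {x y : L} (hx : x ∈ A.deg i) (hy : y ∈ A.deg j)
    (l : List (A.ConeLetter V)) :
    V.projectionOnto K hVK (A.iterAd (A.vals l) (A.bracket x y)) =
      splitSum A.coneParity (fun S T => V.projectionOnto K hVK (A.iterAd (A.vals T)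
        (A.bracket x (V.projectionOnto K hVK (A.iterAd (A.vals S) y))))) l -
      (-1 : ℤˣ) ^ (i * j) • splitSum A.coneParity (fun S T =>
        V.projectionOnto K hVK (A.iterAd (A.vals T)
        (A.bracket y (V.projectionOnto K hVK (A.iterAd (A.vals S) x))))) l := by
  rw [iterAd_bracket hx hy, map_splitSum, ← splitSum_smul, sub_eq_neg_add, ← splitSum_neg,
    ← splitSum_swap _ (fun S T => V.projectionOnto K hVK (A.iterAd (A.vals T)
        (A.bracket x (V.projectionOnto K hVK (A.iterAd (A.vals S) y))))), ← splitSum_add]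
  congr 1
  funext S T
  have hS := iterAd_mem hx S
  have hT := iterAd_mem hy T
  have hPS := projectionOnto_mem_deg hK hV hVK hS
  have hPT := projectionOnto_mem_deg hK hV hVK hT
  rw [map_units_int_smul, projectionOnto_bracket hK hV hVK,
    A.bracket_skew hPS hT, bracket_iterAd hV (Subtype.prop _) hPS,
    bracket_iterAd hV (Subtype.prop _) hPT, smul_add]
  simp only [map_units_int_smul, smul_smul, ← uzpow_add]
  rw [← negOnePow_add_one_smul]
  generalize listParity A.coneParity S = s
  generalize listParity A.coneParity T = t
  have e₁ : ∀ i j s t : ZMod 2,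
    j * s + ((i + s) * (j + t) + 1 + (i + s) * t) = i * j + 1 := by decide
  have e₂ : ∀ j s t : ZMod 2, j * s + (j + t) * s = s * t := by decide
  rw [e₂, ← e₁ i j s t, add_assoc]

/-- Apply P to `derivation_iterAd` and split each bracket with `projectionOnto_bracket`. Projecting
the first factor yields the left-hand terms, projecting the second one the terms on the right. -/
theorem splitSum_projectionOnto_derivation (hK : A.IsSubalgebra K)
    (hV : A.IsAbelianSubalgebra V) (hVK : IsCompl V K) {D : L →ₗ[k] L}
    (hD : A.IsOddDerivation D) (hDK : ∀ x ∈ K, D x ∈ K) {i : ZMod 2} {x : L} (hx : x ∈ A.deg i)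
    (l : List (A.ConeLetter V)) :
    splitSum A.coneParity (fun S T => V.projectionOnto K hVK (A.iterAd (A.vals T)
        (D (V.projectionOnto K hVK (A.iterAd (A.vals S) x))))) l =
      V.projectionOnto K hVK (A.iterAd (A.vals l) (D x)) +
      (-1 : ℤˣ) ^ i • splitSum A.coneParity (fun S T =>
        V.projectionOnto K hVK (A.iterAd (A.vals T)
        (A.bracket x (V.projectionOnto K hVK (A.derivedAd D (A.vals S)))))) l := by
  set P := V.projectionOnto K hVK with hP
  -- The term with empty `T` is absent from the bracket expansion; PDP = PD identifies it with the
  -- projection of D applied to the full iterated bracket, entered here as a sum over splittings.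
  let e : List (A.ConeLetter V) → List (A.ConeLetter V) → V := fun S T =>
    if T = [] then P (D (A.iterAd (A.vals S) x)) else 0
  have he : splitSum A.coneParity e l = P (D (A.iterAd (A.vals l) x)) := by
    rw [splitSum_nil_right _ e (by simp [e])]
    simp [e]
  let b : List (A.ConeLetter V) → List (A.ConeLetter V) → V := fun S T =>
    P (A.iterAd (A.vals T) (A.bracket x (P (A.derivedAd D (A.vals S)))))
  have key : ∀ S T : List (A.ConeLetter V),
      (-1 : ℤˣ) ^ i • P ((-1 : ℤˣ) ^ (listParity A.coneParity S) •
        A.bracket (A.iterAd (A.vals S) x) (A.derivedAd D (A.vals T))) =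
      (e S T - P (A.iterAd (A.vals T) (D (P (A.iterAd (A.vals S) x))))) + (-1 : ℤˣ) ^ i •
        (-1 : ℤˣ) ^ (listParity A.coneParity S * listParity A.coneParity T) • b T S := by
    intro S T
    have hPS := projectionOnto_mem_deg hK hV hVK (iterAd_mem hx S)
    have hPT := projectionOnto_mem_deg hK hV hVK (derivedAd_mem hD T)
    rw [map_units_int_smul, projectionOnto_bracket hK hV hVK, smul_add, smul_add,
      bracket_iterAd hV (Subtype.prop _) hPT]
    congr 1
    · cases T with
      | nil =>
        simp only [e, if_true, vals_nil, iterAd_nil, derivedAd_nil, map_zero, smul_zero]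
        rw [hP, projectionOnto_map_projectionOnto hVK hDK, sub_self]
      | cons u T =>
        rw [bracket_derivedAd_cons hD hV (Subtype.prop _) hPS]
        simp only [map_units_int_smul, smul_smul, ← uzpow_add, e, reduceCtorEq, if_false, zero_sub]
        rw [neg_eq_negOnePow_smul]
        congr 2
        generalize listParity A.coneParity S = s
        clear hx hPS
        revert i s; decide
    · simp only [map_units_int_smul, smul_smul, ← uzpow_add, b]
      congr 2
      generalize listParity A.coneParity S = s
      generalize listParity A.coneParity T = t
      clear hx hPS
      revert i s t; decide
  have h := congrArg P (derivation_iterAd hD hx l)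
  rw [map_add, map_units_int_smul, map_splitSum, ← splitSum_smul,
    splitSum_congr _ l (fun S T _ => key S T), splitSum_add, splitSum_sub, splitSum_smul,
    splitSum_swap, he, ← sub_eq_zero] at h
  rw [← sub_eq_zero, ← h]
  abel

/-- If the first letter `u` lies in the inner part, the preceding identity with x = Du applies, and
D² = 0 removes its first term. What remains cancels against the splittings with `u` in the outer
part, by the symmetry of [Da, b]. -/
theorem splitSum_projectionOnto_derivedAd (hK : A.IsSubalgebra K)
    (hV : A.IsAbelianSubalgebra V) (hVK : IsCompl V K) {D : L →ₗ[k] L}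
    (hD : A.IsOddDerivation D) (hDK : ∀ x ∈ K, D x ∈ K) (hD2 : ∀ x, D (D x) = 0)
    (l : List (A.ConeLetter V)) :
    splitSum A.coneParity (fun S T => V.projectionOnto K hVK (A.iterAd (A.vals T)
        (D (V.projectionOnto K hVK (A.derivedAd D (A.vals S)))))) l = 0 := by
  cases l with
  | nil => simp
  | cons u l =>
    have h := splitSum_projectionOnto_derivation hK hV hVK hD hDK (hD.odd _ _ u.snd_mem) l
    rw [splitSum_cons]
    simp only [vals_cons, derivedAd_cons, iterAd_cons]
    rw [h, hD2, map_zero, map_zero, zero_add, ← splitSum_smul, ← splitSum_add,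
      splitSum_congr (g := fun _ _ => 0), splitSum_zero]
    intro S T _
    rw [hD.bracket_comm hV u.2.1.2.2 (Subtype.prop _) u.snd_mem
      (projectionOnto_mem_deg hK hV hVK (derivedAd_mem hD S))]
    have e : ∀ p s : ZMod 2, p + 1 + p * (s + 1) = p * s + 1 := by decide
    rw [map_units_int_smul, map_units_int_smul, smul_smul, ← uzpow_add, e,
      negOnePow_add_one_smul, neg_add_cancel]

end LieSuperalgebra

/-! ### From functions on lists to multilinear maps. -/

section OfFn

variable {α : Type*}

theorem List.ofFn_update {n : ℕ} (a : Fin n → α) (i : Fin n) (u : α) :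
    List.ofFn (Function.update a i u) =
      (List.ofFn a).take i ++ u :: (List.ofFn a).drop (i + 1) := by
  have h : (List.ofFn a).set i u = (List.ofFn a).take i ++ u :: (List.ofFn a).drop (i + 1) := by
    rw [List.set_eq_take_append_cons_drop, if_pos (by simp)]
  rw [← h]
  refine List.ext_getElem (by simp) fun j h h' => ?_
  simp only [List.getElem_ofFn, List.getElem_set, Function.update_apply, Fin.ext_iff, eq_comm]

theorem List.ofFn_eq_take_append {n : ℕ} (a : Fin (n + 1) → α) (i : Fin n) :
    List.ofFn a =
      (List.ofFn a).take i ++ a i.castSucc :: a i.succ :: (List.ofFn a).drop (i + 2) := by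
  have h1 : (i : ℕ) < (List.ofFn a).length := by simp
  have h2 : (i : ℕ) + 1 < (List.ofFn a).length := by simp
  conv_lhs => rw [← List.take_append_drop i (List.ofFn a), List.drop_eq_getElem_cons h1,
    List.drop_eq_getElem_cons h2]
  rw [List.getElem_ofFn, List.getElem_ofFn]
  rfl

theorem List.ofFn_comp_swap {n : ℕ} (a : Fin (n + 1) → α) (i : Fin n) :
    List.ofFn (fun j => a (Equiv.swap i.castSucc i.succ j)) =
      (List.ofFn a).take i ++ a i.succ :: a i.castSucc :: (List.ofFn a).drop (i + 2) := by
  rw [List.ofFn_eq_take_append _ i]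
  simp only [Equiv.swap_apply_left, Equiv.swap_apply_right]
  congr 1
  · refine List.ext_getElem (by simp) fun j h h' => ?_
    simp only [List.length_take, List.length_ofFn, lt_inf_iff] at h
    simp only [List.getElem_take, List.getElem_ofFn]
    rw [Equiv.swap_apply_of_ne_of_ne] <;> simp [Fin.ext_iff] <;> omega
  · congr 2
    refine List.ext_getElem (by simp) fun j h h' => ?_
    simp only [List.getElem_drop, List.getElem_ofFn]
    rw [Equiv.swap_apply_of_ne_of_ne] <;> simp [Fin.ext_iff] <;> omega

/-- A function on lists which is linear in each entry, as a multilinear map on tuples. -/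
def multilinearOfList {k M N : Type*} [Field k] [AddCommGroup M] [AddCommGroup N] [Module k M]
    [Module k N] (f : List M → N) (hf : ∀ S T, IsLinearMap k fun u => f (S ++ u :: T)) (n : ℕ) :
    MultilinearMap k (fun _ : Fin n => M) N :=
  MultilinearMap.mk' (fun a => f (List.ofFn a))
    (fun a i x y => by simpa only [List.ofFn_update] using (hf _ _).map_add x y)
    (fun a i c x => by simpa only [List.ofFn_update] using (hf _ _).map_smul c x)

end OfFn

/-- Graded symmetry only has to be checked on exchanges of neighbours. -/
theorem isGradedSymmetric_of_swapSymm {k W : Type*} [Field k] [AddCommGroup W] [Module k W]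
    {deg : ZMod 2 → Submodule k W} (B : (n : ℕ) → MultilinearMap k (fun _ : Fin n => W) W)
    (f : List W → W) (hB : ∀ n a, B n a = f (List.ofFn a))
    (hf : SwapSymm (fun u : Σ p, deg p => u.1) fun l => f (l.map fun u => u.2.1)) :
    IsGradedSymmetric deg B := by
  intro n p a ha σ
  cases n with
  | zero => simp [Subsingleton.elim σ 1, koszulSign_one]
  | succ n =>
    -- Adjacent transpositions generate the permutations, and the multiplicativity of the Koszul
    -- sign extends the claim to products; parities and arguments vary, since the second factor acts
    -- on the tuple already permuted.
    have hσ : σ ∈ Submonoid.closure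
        (Set.range fun i : Fin n => Equiv.swap i.castSucc i.succ) := by
      rw [Equiv.Perm.mclosure_swap_castSucc_succ]
      trivial
    induction hσ using Submonoid.closure_induction generalizing p a with
    | mem σ h =>
      obtain ⟨i, rfl⟩ := h
      rw [koszulSign_swap_castSucc_succ, hB, hB]
      have h1 := List.ofFn_comp_swap (fun i => (⟨p i, a i, ha i⟩ : Σ p, deg p)) i
      have h2 := List.ofFn_eq_take_append (fun i => (⟨p i, a i, ha i⟩ : Σ p, deg p)) i
      have h3 := hf ((List.ofFn (fun i => (⟨p i, a i, ha i⟩ : Σ p, deg p))).take i)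
        ((List.ofFn (fun i => (⟨p i, a i, ha i⟩ : Σ p, deg p))).drop (i + 2))
        ⟨p i.succ, a i.succ, ha i.succ⟩ ⟨p i.castSucc, a i.castSucc, ha i.castSucc⟩
      rw [← h1, ← h2, mul_comm] at h3
      beta_reduce at h3
      rw [List.map_ofFn, List.map_ofFn] at h3
      exact h3
    | one => simp [koszulSign_one]
    | mul σ τ _ _ hσ hτ =>
      rw [koszulSign_mul, mul_comm, mul_smul, ← hσ p a ha, ← hτ (p ∘ σ) (fun i => a (σ i))
        (fun i => ha _)]
      rfl

/-! ### The closed formula for the brackets: linearity, parity, symmetry. -/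

namespace LieSuperalgebra

variable {k L : Type*} [Field k] [AddCommGroup L] [Module k L] (A : LieSuperalgebra k L)
  {K V : Submodule k L}

/-- The sum of `± […[[xᵢ, a₁], …], aₙ]` (with `aᵢ` omitted) for a list of elements `(Πxᵢ, aᵢ)`. -/
noncomputable def mixedAd : List (L × V) → L
  | [] => 0
  | u :: l => A.iterAd l u.1 - A.bracket (A.gradingInvolution u.2) (mixedAd l)

/-- The `L`-component of the brackets of elements `(Πxᵢ, aᵢ)`. -/
noncomputable def lowBracket (D : L →ₗ[k] L) : List (L × V) → L
  | [u] => -D u.1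
  | [u, v] => A.bracket (A.gradingInvolution u.1) v.1
  | _ => 0

/-- The brackets on `ΠL ⊕ V`, as a function on lists. -/
noncomputable def coneBracket (hVK : IsCompl V K) (D : L →ₗ[k] L) (l : List (L × V)) : L × V :=
  (A.lowBracket D l, V.projectionOnto K hVK (A.mixedAd l + A.derivedAd D l))

variable {A}

@[simp] theorem mixedAd_nil : A.mixedAd ([] : List (L × V)) = 0 := rfl

@[simp] theorem mixedAd_cons (u : L × V) (l : List (L × V)) : A.mixedAd (u :: l) =
    A.iterAd l u.1 - A.bracket (A.gradingInvolution u.2) (A.mixedAd l) := rfl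

@[simp] theorem lowBracket_nil (D : L →ₗ[k] L) : A.lowBracket D ([] : List (L × V)) = 0 := rfl

@[simp] theorem lowBracket_singleton (D : L →ₗ[k] L) (u : L × V) :
    A.lowBracket D [u] = -D u.1 := rfl

@[simp] theorem lowBracket_pair (D : L →ₗ[k] L) (u v : L × V) :
    A.lowBracket D [u, v] = A.bracket (A.gradingInvolution u.1) v.1 := rfl

theorem lowBracket_eq_zero (D : L →ₗ[k] L) {l : List (L × V)} (h : 3 ≤ l.length) :
    A.lowBracket D l = 0 := by
  match l, h with
  | _ :: _ :: _ :: _, _ => rfl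

theorem isLinearMap_iterAd (x : L) (S T : List (L × V)) :
    IsLinearMap k fun u => A.iterAd (S ++ u :: T) x := by
  constructor <;> intros <;> simp [iterAd_append]

theorem isLinearMap_mixedAd (S T : List (L × V)) :
    IsLinearMap k fun u => A.mixedAd (S ++ u :: T) := by
  induction S with
  | nil =>
    constructor <;> intros <;> simp [smul_sub]
    abel
  | cons v S ih =>
    have h := isLinearMap_iterAd (A := A) v.1 S T
    constructor <;> intros <;> simp [ih.map_add, ih.map_smul, h.map_add, h.map_smul, smul_sub]
    abel

theorem isLinearMap_derivedAd (D : L →ₗ[k] L) (S T : List (L × V)) :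
    IsLinearMap k fun u => A.derivedAd D (S ++ u :: T) := by
  cases S with
  | nil => constructor <;> intros <;> simp
  | cons v S => exact isLinearMap_iterAd (A := A) _ S T

theorem isLinearMap_lowBracket (D : L →ₗ[k] L) (S T : List (L × V)) :
    IsLinearMap k fun u => A.lowBracket D (S ++ u :: T) := by
  by_cases h : 3 ≤ (S ++ 0 :: T).length
  · have h' : ∀ u, A.lowBracket D (S ++ u :: T) = 0 := fun u =>
      lowBracket_eq_zero D (by simpa using h)
    constructor <;> intros <;> simp [h']
  · match S, T with
    | [], [] => constructor <;> intros <;> simp [add_comm]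
    | [], [_] => constructor <;> intros <;> simp
    | [_], [] => constructor <;> intros <;> simp
    | [], _ :: _ :: _ => simp at h
    | _ :: _ :: _, _ => simp at h
    | [_], _ :: _ => simp at h

theorem isLinearMap_coneBracket (hVK : IsCompl V K) (D : L →ₗ[k] L) (S T : List (L × V)) :
    IsLinearMap k fun u => A.coneBracket hVK D (S ++ u :: T) := by
  have h1 := isLinearMap_lowBracket (A := A) D S T
  have h2 := isLinearMap_mixedAd (A := A) S T
  have h3 := isLinearMap_derivedAd (A := A) D S T
  constructor <;> intros <;>
    simp [coneBracket, h1.map_add, h1.map_smul, h2.map_add, h2.map_smul, h3.map_add, h3.map_smul]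
  abel

theorem gradingInvolution_mem {i : ZMod 2} {x : L} (hx : x ∈ A.deg i) :
    A.gradingInvolution x ∈ A.deg i := by
  rw [A.gradingInvolution_apply hx]
  exact A.negOnePow_smul_mem _ hx

theorem mixedAd_mem (l : List (A.ConeLetter V)) :
    A.mixedAd (A.vals l) ∈ A.deg (listParity A.coneParity l + 1) := by
  induction l with
  | nil => exact zero_mem _
  | cons u l ih =>
    rw [listParity_cons]
    refine sub_mem ?_ ?_
    · rw [add_right_comm]
      exact iterAd_mem u.fst_mem l
    · rw [add_assoc]
      exact A.bracket_mem _ _ _ _ (gradingInvolution_mem u.snd_mem) ih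

theorem lowBracket_mem {D : L →ₗ[k] L} (hD : A.IsOddDerivation D) (l : List (A.ConeLetter V)) :
    A.lowBracket D (A.vals l) ∈ A.deg (listParity A.coneParity l + 1 + 1) := by
  match l with
  | [] => exact zero_mem _
  | [u] => simpa using hD.odd _ _ u.fst_mem
  | [u, v] =>
    have e : ∀ p q : ZMod 2, p + (q + 0) + 1 + 1 = p + 1 + (q + 1) := by decide
    simp only [listParity_cons, listParity_nil, e]
    exact A.bracket_mem _ _ _ _ (gradingInvolution_mem u.fst_mem) v.fst_mem
  | _ :: _ :: _ :: _ => exact zero_mem _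

theorem coneBracket_mem (hK : A.IsSubalgebra K) (hV : A.IsAbelianSubalgebra V)
    (hVK : IsCompl V K) {D : L →ₗ[k] L} (hD : A.IsOddDerivation D) (l : List (A.ConeLetter V)) :
    A.coneBracket hVK D (A.vals l) ∈ A.coneDeg V (listParity A.coneParity l + 1) :=
  ⟨lowBracket_mem hD l,
    projectionOnto_mem_deg hK hV hVK (add_mem (mixedAd_mem l) (derivedAd_mem hD l))⟩

theorem swapSymm_iterAd (hV : A.IsAbelianSubalgebra V) (x : L) :
    SwapSymm A.coneParity fun l : List (A.ConeLetter V) => A.iterAd (A.vals l) x := by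
  intro S T a b
  simp only [vals_append, vals_cons, iterAd_append, iterAd_cons]
  rw [hV.bracket_comm a.2.1.2.2 b.2.1.2.2 a.snd_mem b.snd_mem, map_units_int_smul]

theorem swapSymm_derivedAd (hV : A.IsAbelianSubalgebra V) {D : L →ₗ[k] L}
    (hD : A.IsOddDerivation D) :
    SwapSymm A.coneParity fun l : List (A.ConeLetter V) => A.derivedAd D (A.vals l) := by
  intro S T a b
  cases S with
  | nil =>
    simp only [List.nil_append, vals_cons, derivedAd_cons, iterAd_cons]
    rw [hD.bracket_comm hV a.2.1.2.2 b.2.1.2.2 a.snd_mem b.snd_mem, map_units_int_smul]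
  | cons u S => exact swapSymm_iterAd hV _ S T a b

/-- This explains the recursion for `mixedAd`: prepending `v` by −[γv, ·], with γ the grading
involution, amounts to inserting `v` just after Πx with the Koszul sign for exchanging `v` and Πx,
whose parity is `i + 1`. -/
theorem neg_bracket_gradingInvolution_iterAd (hV : A.IsAbelianSubalgebra V) {q i : ZMod 2}
    {v x : L} (hv : v ∈ V) (hvq : v ∈ A.deg q) (hx : x ∈ A.deg i) (l : List (A.ConeLetter V)) :
    -A.bracket (A.gradingInvolution v) (A.iterAd (A.vals l) x) =
      (-1 : ℤˣ) ^ (q * (i + 1)) • A.iterAd (A.vals l) (A.bracket x v) := by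
  rw [A.gradingInvolution_apply hvq, map_units_int_smul, LinearMap.smul_apply,
    A.bracket_skew hvq (iterAd_mem hx l), bracket_iterAd hV hv hvq, neg_eq_negOnePow_smul]
  simp only [smul_smul, ← uzpow_add]
  congr 2
  generalize listParity A.coneParity l = t
  clear hvq hx
  revert q i t; decide

/-- With `a`, `b` in front there are three kinds of terms. Those taking the L-component from `a` and
from `b` are interchanged; in those taking it from a later letter, brackets with two elements of V
commute. -/
theorem swapSymm_mixedAd (hV : A.IsAbelianSubalgebra V) :
    SwapSymm A.coneParity fun l : List (A.ConeLetter V) => A.mixedAd (A.vals l) := by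
  intro S T a b
  induction S with
  | nil =>
    have key := fun a b : A.ConeLetter V =>
      neg_bracket_gradingInvolution_iterAd hV a.2.1.2.2 a.snd_mem b.fst_mem T
    simp only [add_assoc, CharTwo.add_self_eq_zero, add_zero] at key
    have hγ : ∀ a : A.ConeLetter V, A.gradingInvolution a.2.1.2 ∈ V := fun a => by
      rw [A.gradingInvolution_apply a.snd_mem, Units.smul_def]
      exact zsmul_mem a.2.1.2.2 _
    have h1 : A.iterAd (A.vals T) (A.bracket a.2.1.1 b.2.1.2) = (-1 : ℤˣ) ^ (a.1 * b.1) •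
        -A.bracket (A.gradingInvolution b.2.1.2) (A.iterAd (A.vals T) a.2.1.1) := by
      rw [key b a, smul_smul, mul_comm b.1, Int.units_mul_self, one_smul]
    have h2 := hV.bracket_left_comm (hγ a) (hγ b) (gradingInvolution_mem a.snd_mem)
      (gradingInvolution_mem b.snd_mem) (A.mixedAd (A.vals T))
    simp only [List.nil_append, vals_cons, mixedAd_cons, iterAd_cons, map_sub, sub_sub_eq_add_sub]
    rw [add_sub_right_comm, add_sub_right_comm, sub_eq_add_neg, sub_eq_add_neg, key a b, h1, h2,
      ← smul_add, ← smul_add, add_comm (-_)]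
  | cons u S ih =>
    have h := swapSymm_iterAd hV u.2.1.1 S T a b
    simp only [List.cons_append, vals_cons, mixedAd_cons] at ih h ⊢
    rw [ih, h, map_units_int_smul, smul_sub]

/-- The factor (-1)^{x̃} turns the skew symmetry of the bracket of L into symmetry for the shifted
parities. -/
theorem swapSymm_lowBracket {D : L →ₗ[k] L} :
    SwapSymm A.coneParity fun l : List (A.ConeLetter V) => A.lowBracket D (A.vals l) := by
  intro S T a b
  match S, T with
  | [], [] =>
    simp only [List.nil_append, vals_cons, vals_nil, lowBracket_pair]
    rw [A.gradingInvolution_apply a.fst_mem, A.gradingInvolution_apply b.fst_mem,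
      map_units_int_smul, map_units_int_smul, LinearMap.smul_apply, LinearMap.smul_apply,
      A.bracket_skew a.fst_mem b.fst_mem]
    simp only [smul_smul, ← uzpow_add]
    congr 2
    change a.1 + 1 + ((a.1 + 1) * (b.1 + 1) + 1) = a.1 * b.1 + (b.1 + 1)
    generalize a.1 = p
    generalize b.1 = q
    revert p q; decide
  | [], _ :: _ => simp [lowBracket_eq_zero]
  | _ :: S, T =>
    simp only []
    rw [lowBracket_eq_zero, lowBracket_eq_zero, smul_zero] <;> simp [vals] <;> omega

theorem swapSymm_coneBracket (hV : A.IsAbelianSubalgebra V) (hVK : IsCompl V K) {D : L →ₗ[k] L}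
    (hD : A.IsOddDerivation D) :
    SwapSymm A.coneParity fun l : List (A.ConeLetter V) => A.coneBracket hVK D (A.vals l) := by
  intro S T a b
  have h := ((swapSymm_mixedAd hV).add (swapSymm_derivedAd hV hD)).map
    (V.projectionOnto K hVK).toAddMonoidHom S T a b
  exact Prod.ext (swapSymm_lowBracket S T a b) h

end LieSuperalgebra

/-! ### Characterisation and uniqueness of the brackets. -/

namespace LieSuperalgebra

variable {k L : Type*} [Field k] [AddCommGroup L] [Module k L] {A : LieSuperalgebra k L}
  {K V : Submodule k L}

theorem iterAd_eq_zero {l : List (L × V)} (h : ∃ u ∈ l, u.2 = 0) (x : L) : A.iterAd l x = 0 := by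
  obtain ⟨u, hu, h0⟩ := h
  obtain ⟨S, T, rfl⟩ := List.append_of_mem hu
  simp [iterAd_append, h0]

theorem derivedAd_eq_zero (D : L →ₗ[k] L) {l : List (L × V)} (h : ∃ u ∈ l, u.2 = 0) :
    A.derivedAd D l = 0 := by
  cases l with
  | nil => rfl
  | cons v l =>
    obtain ⟨u, hu, h0⟩ := h
    rcases List.mem_cons.1 hu with rfl | hu
    · simp [h0]
    · exact iterAd_eq_zero ⟨u, hu, h0⟩ _

theorem exists_snd_eq_zero {l : List (L × V)}
    (h : ¬l.Pairwise fun u v => u.2 ≠ 0 ∨ v.2 ≠ 0) : ∃ u ∈ l, u.2 = 0 := by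
  by_contra! hc
  exact h (List.pairwise_of_forall_mem_list fun u hu _ _ => Or.inl (hc u hu))

/-- Each summand omits the V-component of a single letter, so a vanishing one survives among any
two. -/
theorem mixedAd_eq_zero {l : List (L × V)}
    (h : ¬l.Pairwise fun u v => u.2 ≠ 0 ∨ v.2 ≠ 0) : A.mixedAd l = 0 := by
  induction l with
  | nil => rfl
  | cons u l ih =>
    rw [mixedAd_cons]
    by_cases hl : l.Pairwise fun u v => u.2 ≠ 0 ∨ v.2 ≠ 0
    · rw [List.pairwise_cons, not_and'] at h
      obtain ⟨v, hv, hc⟩ : ∃ v ∈ l, ¬(u.2 ≠ 0 ∨ v.2 ≠ 0) := by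
        by_contra! hc
        exact h hl fun v hv => hc v hv
      rw [not_or, not_not, not_not] at hc
      rw [iterAd_eq_zero ⟨v, hv, hc.2⟩, hc.1]
      simp
    · rw [iterAd_eq_zero (exists_snd_eq_zero hl), ih hl]
      simp

theorem coneBracket_eq_zero (hVK : IsCompl V K) (D : L →ₗ[k] L) {l : List (L × V)}
    (h3 : 3 ≤ l.length) (h : ¬l.Pairwise fun u v => u.2 ≠ 0 ∨ v.2 ≠ 0) :
    A.coneBracket hVK D l = 0 := by
  rw [coneBracket, lowBracket_eq_zero D h3, mixedAd_eq_zero h,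
    derivedAd_eq_zero D (exists_snd_eq_zero h), add_zero, map_zero, Prod.mk_zero_zero]

theorem mixedAd_eq_zero_of_fst {l : List (L × V)} (h : ∀ u ∈ l, u.1 = 0) : A.mixedAd l = 0 := by
  induction l with
  | nil => rfl
  | cons u l ih => simp_all

theorem lowBracket_eq_zero_of_fst (D : L →ₗ[k] L) {l : List (L × V)} (h : ∀ u ∈ l, u.1 = 0) :
    A.lowBracket D l = 0 := by
  match l with
  | [] => rfl
  | [u] => simp_all
  | [u, v] => simp_all
  | _ :: _ :: _ :: _ => rfl

theorem coneBracket_of_fst (hVK : IsCompl V K) (D : L →ₗ[k] L) {l : List (L × V)}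
    (h : ∀ u ∈ l, u.1 = 0) :
    A.coneBracket hVK D l = (0, V.projectionOnto K hVK (A.derivedAd D l)) := by
  rw [coneBracket, mixedAd_eq_zero_of_fst h, lowBracket_eq_zero_of_fst D h, zero_add]

theorem coneBracket_cons (hVK : IsCompl V K) (D : L →ₗ[k] L) (u : L × V) {l : List (L × V)}
    (hl : l ≠ []) (h : ∀ u ∈ l, u.1 = 0) :
    A.coneBracket hVK D (u :: l) = (0, V.projectionOnto K hVK (A.iterAd l (u.1 + D u.2))) := by
  have h1 : A.lowBracket D (u :: l) = 0 := by
    match l with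
    | [] => exact absurd rfl hl
    | [v] => simp_all
    | _ :: _ :: _ => rfl
  rw [coneBracket, h1, mixedAd_cons, derivedAd_cons, mixedAd_eq_zero_of_fst h]
  simp

theorem iterAd_ofFn {n : ℕ} (x : L) (a : Fin n → V) :
    A.iterAd (List.ofFn fun i => ((0 : L), a i)) x = A.iterBracket n x fun i => (a i : L) := by
  induction n generalizing x with
  | zero => simp [iterBracket]
  | succ n ih =>
    rw [List.ofFn_succ, iterAd_cons, ih, iterBracket]
    rfl

variable (A) in
/-- The brackets on `ΠL ⊕ V`. -/
noncomputable def coneBrackets (hVK : IsCompl V K) (D : L →ₗ[k] L) (n : ℕ) :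
    MultilinearMap k (fun _ : Fin n => L × V) (L × V) :=
  multilinearOfList (A.coneBracket hVK D) (isLinearMap_coneBracket hVK D) n

theorem coneBrackets_apply (hVK : IsCompl V K) (D : L →ₗ[k] L) (n : ℕ) (a : Fin n → L × V) :
    A.coneBrackets hVK D n a = A.coneBracket hVK D (List.ofFn a) := rfl

theorem isConeBrackets_coneBrackets (hV : A.IsAbelianSubalgebra V) (hVK : IsCompl V K)
    {D : L →ₗ[k] L} (hD : A.IsOddDerivation D) :
    A.IsConeBrackets hVK D (A.coneBrackets hVK D) where
  symm := isGradedSymmetric_of_swapSymm _ _ (coneBrackets_apply hVK D)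
    (swapSymm_coneBracket hV hVK hD)
  nullary := by
    ext a
    all_goals simp [coneBrackets_apply, coneBracket]
  unary x a := by simp [coneBrackets_apply, coneBracket]
  binary i x y hx := by
    simp [coneBrackets_apply, coneBracket, A.gradingInvolution_apply hx]
  mixed n x a hn := by
    rw [coneBrackets_apply, List.ofFn_cons, coneBracket_cons, iterAd_ofFn]
    · simp
    · intro h
      have := congrArg List.length h
      simp at this
      omega
    · simp [List.mem_ofFn]
  derived n a := by
    rw [coneBrackets_apply, coneBracket_of_fst, List.ofFn_succ, derivedAd_cons, iterAd_ofFn]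
    simp [List.mem_ofFn]
  others n u i j hn hij hi hj := by
    refine coneBracket_eq_zero hVK D (by simpa using hn) fun h => ?_
    rw [List.pairwise_ofFn] at h
    rcases lt_or_gt_of_ne hij with h' | h'
    · exact (h h').elim (fun h => h hi) (fun h => h hj)
    · exact (h h').elim (fun h => h hj) (fun h => h hi)

/-- The homogeneous elements lying in one of the summands of `ΠL ⊕ V`. -/
def IsPure (A : LieSuperalgebra k L) (V : Submodule k L) (u : L × V) : Prop :=
  (∃ p, u ∈ A.coneDeg V p) ∧ (u.1 = 0 ∨ u.2 = 0)

theorem span_isPure (hV : A.IsAbelianSubalgebra V) :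
    Submodule.span k {u : L × V | A.IsPure V u} = ⊤ := by
  rw [eq_top_iff]
  rintro ⟨x, a⟩ -
  obtain ⟨y, hy, z, hz, rfl⟩ := A.exists_homogeneous_add x
  obtain ⟨b, c, hb, hb', hc, hc', e⟩ := hV.graded.exists_add a.2
  have h : ((y + z, a) : L × V) = ((y, 0) + (z, 0)) + ((0, ⟨b, hb⟩) + (0, ⟨c, hc⟩)) := by
    ext <;> simp [e]
  rw [h]
  refine add_mem (add_mem ?_ ?_) (add_mem ?_ ?_) <;> refine Submodule.subset_span ?_
  · exact ⟨⟨1, hy, zero_mem _⟩, Or.inr rfl⟩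
  · exact ⟨⟨0, hz, zero_mem _⟩, Or.inr rfl⟩
  · exact ⟨⟨0, zero_mem _, hb'⟩, Or.inl rfl⟩
  · exact ⟨⟨1, zero_mem _, hc'⟩, Or.inl rfl⟩

/-- Multilinear maps are determined by their values on the spanning pure elements. There, the number
of arguments with zero V-component (at least two, exactly one, none) decides which prescribed
formula applies. -/
theorem IsConeBrackets.unique (hV : A.IsAbelianSubalgebra V) {hVK : IsCompl V K}
    {D : L →ₗ[k] L} {B B' : (n : ℕ) → MultilinearMap k (fun _ : Fin n => L × V) (L × V)}
    (hB : A.IsConeBrackets hVK D B) (hB' : A.IsConeBrackets hVK D B') : B = B' := by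
  funext n
  suffices H : ∀ a, (∀ i, A.IsPure V (a i)) → B n a = B' n a from
    MultilinearMap.ext_of_span_eq_top (g := fun _ (u : {u : L × V // A.IsPure V u}) => u.1)
      (fun _ => by simpa using span_isPure hV) fun j => H _ fun i => (j i).2
  intro a ha
  cases n with
  | zero => rw [hB.nullary, hB'.nullary]
  | succ n =>
  by_cases h : ∃ i j, i ≠ j ∧ (a i).2 = 0 ∧ (a j).2 = 0
  · obtain ⟨i, j, hij, hi, hj⟩ := h
    by_cases hn : 3 ≤ n + 1
    · rw [hB.others _ a i j hn hij hi hj, hB'.others _ a i j hn hij hi hj]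
    · obtain rfl : n = 1 := by omega
      have h2 : ∀ l, (a l).2 = 0 := fun l => by
        rcases (show l = i ∨ l = j by omega) with rfl | rfl <;> assumption
      have e : a = ![((a 0).1, 0), ((a 1).1, 0)] := by
        funext l
        fin_cases l
        · exact Prod.ext rfl (h2 0)
        · exact Prod.ext rfl (h2 1)
      obtain ⟨p, hp⟩ := (ha 0).1
      rw [e, hB.binary (p + 1) _ _ hp.1, hB'.binary (p + 1) _ _ hp.1]
  push Not at h
  by_cases hL : ∃ i, (a i).2 = 0
  · obtain ⟨i, hi⟩ := hL
    have hV : ∀ j, j ≠ i → (a j).1 = 0 := fun j hj =>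
      (ha j).2.resolve_right (h i j hj.symm hi)
    choose p hp using fun j => (ha j).1
    -- The swap brings the only argument from ΠL to the front; both systems acquire the same
    -- invertible sign.
    have e1 := hB.symm (n + 1) p a hp (Equiv.swap 0 i)
    have e2 := hB'.symm (n + 1) p a hp (Equiv.swap 0 i)
    suffices B (n + 1) (fun j => a (Equiv.swap 0 i j)) =
        B' (n + 1) (fun j => a (Equiv.swap 0 i j)) from
      smul_left_cancel _ (e1.symm.trans (this.trans e2))
    have e : (fun j => a (Equiv.swap 0 i j)) =
        Fin.cons ((a i).1, 0) fun j : Fin n => (0, (a (Equiv.swap 0 i j.succ)).2) := by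
      funext j
      cases j using Fin.cases with
      | zero => simp [← hi]
      | succ j =>
        refine Prod.ext (hV _ fun hj => ?_) rfl
        rw [Equiv.swap_apply_eq_iff, Equiv.swap_apply_right] at hj
        exact Fin.succ_ne_zero j hj
    rw [e]
    cases n with
    | zero =>
      have e' : ∀ w : Fin 0 → L × V,
          (Fin.cons ((a i).1, 0) w : Fin 1 → L × V) = ![((a i).1, 0)] := fun w => by
        funext j
        fin_cases j
        rfl
      rw [e', hB.unary, hB'.unary]
    | succ n => rw [hB.mixed _ _ _ (by omega), hB'.mixed _ _ _ (by omega)]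
  · push Not at hL
    have e : a = fun i => (0, (a i).2) := by
      funext i
      exact Prod.ext ((ha i).2.resolve_right (hL i)) rfl
    rw [e, hB.derived, hB'.derived]

theorem isInternal_coneDeg (hV : A.IsAbelianSubalgebra V) :
    DirectSum.IsInternal (A.coneDeg V) := by
  rw [isInternal_zmod_two_iff]
  constructor
  · rw [Submodule.disjoint_def]
    rintro ⟨x, a⟩ h h'
    have e := Submodule.disjoint_def.1 A.isCompl_deg.disjoint
    exact Prod.ext (e x h'.1 h.1) (Subtype.ext (e a h.2 h'.2))
  · rw [codisjoint_iff_le_sup, ← span_isPure hV, Submodule.span_le]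
    rintro u ⟨⟨p, hp⟩, -⟩
    obtain rfl | rfl := zmod_two_cases p
    · exact Submodule.mem_sup_left hp
    · exact Submodule.mem_sup_right hp

end LieSuperalgebra

/-- `splitSum` is additive in each letter. -/
theorem splitSum_letter_add {α M : Type*} [AddCommGroup M] (par : α → ZMod 2) {a b c : α}
    (hb : par b = par a) (hc : par c = par a) (f : List α → List α → M)
    (h₁ : ∀ S T R, f (S ++ a :: T) R = f (S ++ b :: T) R + f (S ++ c :: T) R)
    (h₂ : ∀ S T R, f R (S ++ a :: T) = f R (S ++ b :: T) + f R (S ++ c :: T)) (S T : List α) :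
    splitSum par f (S ++ a :: T) = splitSum par f (S ++ b :: T) + splitSum par f (S ++ c :: T) := by
  induction S generalizing f with
  | nil =>
    simp only [List.nil_append, splitSum_cons', ← splitSum_add]
    congr 1
    funext S R
    rw [show f (a :: S) R = _ from h₁ [] S R, show f S (a :: R) = _ from h₂ [] R S, hb, hc,
      smul_add]
    exact add_add_add_comm _ _ _ _
  | cons d S ih =>
    refine ih _ (fun S T R => ?_) (fun S T R => ?_)
    · rw [show f (d :: (S ++ a :: T)) R = _ from h₁ (d :: S) T R, h₁ S T (d :: R)]
      simp only [listParity_append, listParity_cons, hb, hc, smul_add]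
      exact add_add_add_comm _ _ _ _
    · rw [show f R (d :: (S ++ a :: T)) = _ from h₂ (d :: S) T R, h₂ S T (d :: R), smul_add]
      exact add_add_add_comm _ _ _ _

/-! ### The Jacobiator with at most one argument from ΠL. -/

namespace LieSuperalgebra

variable {k L : Type*} [Field k] [AddCommGroup L] [Module k L] {A : LieSuperalgebra k L}
  {K V : Submodule k L}

theorem fst_eq_zero_of_mem_vals {l : List (A.ConeLetter V)} (h : ∀ u ∈ l, u.2.1.1 = 0) :
    ∀ u ∈ A.vals l, u.1 = 0 := List.forall_mem_map.2 h

theorem vals_ne_nil {l : List (A.ConeLetter V)} (h : l ≠ []) : A.vals l ≠ [] := by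
  simpa [vals] using h

theorem coneBracket_nil (hVK : IsCompl V K) (D : L →ₗ[k] L) : A.coneBracket hVK D [] = 0 := by
  simp [coneBracket]

theorem coneBracket_zero_cons (hVK : IsCompl V K) (D : L →ₗ[k] L) (l : List (L × V)) :
    A.coneBracket hVK D (0 :: l) = 0 := (isLinearMap_coneBracket hVK D [] l).map_zero

theorem coneBracket_singleton (hVK : IsCompl V K) (D : L →ₗ[k] L) (u : L × V) :
    A.coneBracket hVK D [u] = (-D u.1, V.projectionOnto K hVK (u.1 + D u.2)) := by
  simp [coneBracket]

theorem coneBracket_pair (hVK : IsCompl V K) (D : L →ₗ[k] L) {u v : L × V}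
    (hu : u.2 = 0) (hv : v.2 = 0) :
    A.coneBracket hVK D [u, v] = (A.bracket (A.gradingInvolution u.1) v.1, 0) := by
  simp [coneBracket, hu, hv]

theorem coneBracket_cons_cons_eq_zero (hVK : IsCompl V K) (D : L →ₗ[k] L) {u v : L × V}
    (hu : u.2 = 0) (hv : v.2 = 0) {l : List (L × V)} (hl : l ≠ []) :
    A.coneBracket hVK D (u :: v :: l) = 0 := by
  refine coneBracket_eq_zero hVK D ?_ (by simp [hu, hv])
  have := List.length_pos_of_ne_nil hl
  simp only [List.length_cons]
  omega

theorem coneBracket_cons_cons_cons_eq_zero (hVK : IsCompl V K) (D : L →ₗ[k] L) {u v : L × V}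
    (hu : u.2 = 0) (hv : v.2 = 0) (w : L × V) (l : List (L × V)) :
    A.coneBracket hVK D (w :: u :: v :: l) = 0 :=
  coneBracket_eq_zero hVK D (by simp) (by simp [hu, hv])

/-- This evaluates an outer bracket whose first entry `u` is an inner bracket standing before the
argument Πx. The alternative `h` excludes the binary bracket of two L-components; in all other cases
only the V-component of `u` matters. -/
theorem coneBracket_cons_cons (hV : A.IsAbelianSubalgebra V) (hVK : IsCompl V K) (D : L →ₗ[k] L)
    {u : L × V} {q : ZMod 2} (hu : (u.2 : L) ∈ A.deg q) (w : A.ConeLetter V) (hw : w.2.1.2 = 0)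
    {l : List (A.ConeLetter V)} (h : u.1 = 0 ∨ l ≠ []) (hl : ∀ w ∈ l, w.2.1.1 = 0) :
    A.coneBracket hVK D (u :: w.2.1 :: A.vals l) = (-1 : ℤˣ) ^ (q * w.1) •
      (0, V.projectionOnto K hVK (A.iterAd (A.vals l) (A.bracket w.2.1.1 u.2))) := by
  have h0 : A.mixedAd (A.vals l) = 0 := mixedAd_eq_zero_of_fst (fst_eq_zero_of_mem_vals hl)
  have h1 : A.lowBracket D (u :: w.2.1 :: A.vals l) = 0 := by
    cases l with
    | nil => simp [h.resolve_right (by simp)]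
    | cons _ _ => rfl
  have h2 := neg_bracket_gradingInvolution_iterAd hV u.2.2 hu w.fst_mem l
  rw [add_assoc, CharTwo.add_self_eq_zero, add_zero] at h2
  rw [coneBracket, h1, Prod.smul_mk, smul_zero, ← map_units_int_smul, ← h2]
  simp [hw, h0]

variable (A) in
/-- The Jacobiator of the brackets on `ΠL ⊕ V`, as a function on lists. -/
noncomputable def listJacobiator (hVK : IsCompl V K) (D : L →ₗ[k] L)
    (l : List (A.ConeLetter V)) : L × V :=
  splitSum A.coneParity (fun S T => A.coneBracket hVK D
    (A.coneBracket hVK D (A.vals S) :: A.vals T)) l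

theorem jacobiator_coneBrackets (hVK : IsCompl V K) (D : L →ₗ[k] L) {n : ℕ} {p : Fin n → ZMod 2}
    {a : Fin n → L × V} (ha : ∀ i, a i ∈ A.coneDeg V (p i)) :
    jacobiator (A.coneBrackets hVK D) n p a =
      A.listJacobiator hVK D (List.ofFn fun i => ⟨p i, a i, ha i⟩) := by
  rw [listJacobiator, ← sum_shuffles_eq_splitSum]
  simp only [jacobiator, coneBrackets_apply, List.ofFn_cons, vals, List.map_ofFn]
  rfl

/-- The inner bracket is itself a homogeneous letter, so the symmetry of the outer bracket applies
to the remaining arguments. -/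
theorem swapSymm_listJacobiator (hK : A.IsSubalgebra K) (hV : A.IsAbelianSubalgebra V)
    (hVK : IsCompl V K) {D : L →ₗ[k] L} (hD : A.IsOddDerivation D) :
    SwapSymm A.coneParity (A.listJacobiator hVK D) := by
  refine SwapSymm.splitSum (fun T S S' a b => ?_) (fun S => ?_)
  · have h := swapSymm_coneBracket hV hVK hD S S' a b
    have h' := isLinearMap_coneBracket (A := A) hVK D [] (A.vals T)
    simp only at h ⊢
    rw [h]
    exact map_units_int_smul (h'.mk' _) _ _
  · exact (swapSymm_coneBracket hV hVK hD).cons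
      (⟨_, _, coneBracket_mem hK hV hVK hD S⟩ : A.ConeLetter V)

theorem listJacobiator_of_fst (hK : A.IsSubalgebra K) (hV : A.IsAbelianSubalgebra V)
    (hVK : IsCompl V K) {D : L →ₗ[k] L} (hD : A.IsOddDerivation D) (hDK : ∀ x ∈ K, D x ∈ K)
    (hD2 : ∀ x, D (D x) = 0) {l : List (A.ConeLetter V)} (hl : ∀ u ∈ l, u.2.1.1 = 0) :
    A.listJacobiator hVK D l = 0 := by
  have h := congrArg (LinearMap.inr k L V)
    (splitSum_projectionOnto_derivedAd hK hV hVK hD hDK hD2 l)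
  rw [map_zero, map_splitSum] at h
  rw [← h]
  refine splitSum_congr _ _ fun S T hST => ?_
  have hS := fst_eq_zero_of_mem_vals fun u hu => hl u (hST.subset (List.mem_append_left _ hu))
  have hT := fst_eq_zero_of_mem_vals fun u hu => hl u (hST.subset (List.mem_append_right _ hu))
  rw [coneBracket_of_fst hVK D hS, coneBracket_of_fst hVK D (by simpa using hT)]
  rfl

theorem coneBracket_vals_cons_snd (hVK : IsCompl V K) (D : L →ₗ[k] L) {u : A.ConeLetter V}
    (hu : u.2.1.2 = 0) {S : List (A.ConeLetter V)} (hS : ∀ u ∈ S, u.2.1.1 = 0) :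
    A.coneBracket hVK D (A.vals (u :: S)) = (if S = [] then -D u.2.1.1 else 0,
      V.projectionOnto K hVK (A.iterAd (A.vals S) u.2.1.1)) := by
  by_cases h : S = []
  · subst h
    simp [coneBracket_singleton, hu]
  · rw [vals_cons, coneBracket_cons hVK D _ (vals_ne_nil h) (fst_eq_zero_of_mem_vals hS),
      if_neg h, hu]
    simp

theorem listJacobiator_cons (hK : A.IsSubalgebra K) (hV : A.IsAbelianSubalgebra V)
    (hVK : IsCompl V K) {D : L →ₗ[k] L} (hD : A.IsOddDerivation D) (hDK : ∀ x ∈ K, D x ∈ K)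
    (hD2 : ∀ x, D (D x) = 0) {u : A.ConeLetter V} (hu : u.2.1.2 = 0)
    {l : List (A.ConeLetter V)} (hl : ∀ u ∈ l, u.2.1.1 = 0) :
    A.listJacobiator hVK D (u :: l) = 0 := by
  -- With no further arguments the outer bracket can be unary, and there is an L-component, namely
  -- D²x.
  by_cases hne : l = []
  · subst hne
    simp [listJacobiator, splitSum_cons', coneBracket_nil, coneBracket_zero_cons,
      coneBracket_singleton, hu, hD2, projectionOnto_map_projectionOnto hVK hDK,
      -Submodule.coe_projectionOnto_apply]
  have h := congrArg (LinearMap.inr k L V)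
    (splitSum_projectionOnto_derivation hK hV hVK hD hDK u.fst_mem l)
  simp only [map_add, map_units_int_smul, map_splitSum] at h
  rw [negOnePow_add_one_smul, ← splitSum_smul] at h
  -- Only the unary inner bracket of Πx has an L-component, −Dx; its contribution is the first term
  -- on the right of the identity, written as a sum over splittings.
  let e : List (A.ConeLetter V) → List (A.ConeLetter V) → L × V := fun S T =>
    if S = [] then LinearMap.inr k L V
      (V.projectionOnto K hVK (A.iterAd (A.vals T) (D u.2.1.1))) else 0
  have he : splitSum A.coneParity e l = LinearMap.inr k L V
      (V.projectionOnto K hVK (A.iterAd (A.vals l) (D u.2.1.1))) := by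
    rw [splitSum_nil_left _ e (by simp [e])]
    simp [e]
  rw [← he, ← sub_eq_add_neg, ← sub_eq_zero, ← splitSum_sub, ← splitSum_sub] at h
  rw [listJacobiator, splitSum_cons', ← h]
  refine splitSum_congr _ _ fun S T hST => ?_
  have hS : ∀ u ∈ S, u.2.1.1 = 0 := fun u hu => hl u (hST.subset (List.mem_append_left _ hu))
  have hT : ∀ u ∈ T, u.2.1.1 = 0 := fun u hu => hl u (hST.subset (List.mem_append_right _ hu))
  have hS' := fst_eq_zero_of_mem_vals hS
  have hT' := fst_eq_zero_of_mem_vals hT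
  rw [sub_sub_eq_add_sub, add_sub_right_comm]
  congr 1
  · rw [coneBracket_vals_cons_snd hVK D hu hS]
    by_cases h0 : S = []
    · subst h0
      have hTne : T ≠ [] := by
        rintro rfl
        exact hne (by simpa using hST)
      rw [coneBracket_cons hVK D _ (vals_ne_nil hTne) hT']
      simp [e, -Submodule.coe_projectionOnto_apply]
      exact neg_add_eq_sub _ _
    · rw [if_neg h0, coneBracket_of_fst hVK D (by simpa using hT')]
      simp [e, h0]
  · rw [coneBracket_of_fst hVK D hS', vals_cons,
      coneBracket_cons_cons hV hVK D
        (projectionOnto_mem_deg hK hV hVK (derivedAd_mem hD S)) u hu (Or.inl rfl) hT,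
      smul_smul, ← uzpow_add]
    have e : ∀ p s : ZMod 2, p * s + (s + 1) * p = p := by decide
    rw [e]
    rfl

end LieSuperalgebra

/-! ### The Jacobiator with two or more arguments from ΠL, and the conclusion. -/

namespace LieSuperalgebra

variable {k L : Type*} [Field k] [AddCommGroup L] [Module k L] {A : LieSuperalgebra k L}
  {K V : Submodule k L}

/-- The L-component is the Leibniz rule for `D`; the V-component is P[x,y] = P[Px,y] + P[x,Py]. -/
theorem listJacobiator_pair (hK : A.IsSubalgebra K) (hV : A.IsAbelianSubalgebra V)
    (hVK : IsCompl V K) {D : L →ₗ[k] L} (hD : A.IsOddDerivation D) {u w : A.ConeLetter V}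
    (hu : u.2.1.2 = 0) (hw : w.2.1.2 = 0) : A.listJacobiator hVK D [u, w] = 0 := by
  have hbr := projectionOnto_iterAd_bracket hK hV hVK u.fst_mem w.fst_mem []
  simp only [splitSum_nil, vals_nil, iterAd_nil] at hbr
  have hw' := projectionOnto_mem_deg hK hV hVK w.fst_mem
  have hu' := projectionOnto_mem_deg hK hV hVK u.fst_mem
  have h1 := neg_bracket_gradingInvolution_iterAd hV (Subtype.prop _) hw' u.fst_mem []
  have h2 := neg_bracket_gradingInvolution_iterAd hV (Subtype.prop _) hu' w.fst_mem []
  simp only [vals_nil, iterAd_nil] at h1 h2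
  have hx := u.fst_mem
  have hy := w.fst_mem
  simp only [listJacobiator, splitSum_cons', splitSum_nil, listParity_cons, listParity_nil,
    vals_cons, vals_nil, coneBracket_nil, coneBracket_zero_cons, coneBracket_singleton,
    coneBracket_pair hVK D hu hw, smul_zero, mul_zero, add_zero, uzpow_zero, one_smul, hu, hw,
    ZeroMemClass.coe_zero, map_zero, A.gradingInvolution_apply hx]
  refine Prod.ext ?_ ?_
  · simp only [coneBracket, lowBracket_pair, map_neg, LinearMap.neg_apply, Prod.fst_add,
      Prod.smul_fst, Prod.fst_zero, A.gradingInvolution_apply (hD.odd _ _ hx),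
      A.gradingInvolution_apply (hD.odd _ _ hy), map_units_int_smul, LinearMap.smul_apply,
      hD.leibniz _ _ _ hx]
    rw [A.bracket_skew (hD.odd _ _ hy) hx]
    simp only [neg_eq_negOnePow_smul (M := L), smul_smul, ← uzpow_add, smul_add]
    have e₁ : ∀ p : ZMod 2, 1 + (p + 1) = p := by decide
    have e₂ : ∀ p : ZMod 2, 1 + (p + 1 + (p + 1)) = 1 := by decide
    have e₃ : ∀ p r : ZMod 2, p * r + (1 + (r + 1 + 1 + ((r + 1 + 1) * (p + 1) + 1))) = 0 := by
      decide
    rw [e₁, e₂, e₃, e₁, negOnePow_add_one_smul, ← neg_eq_negOnePow_smul, uzpow_zero, one_smul]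
    abel
  · simp only [coneBracket, mixedAd_cons, mixedAd_nil, derivedAd_cons, iterAd_cons, iterAd_nil,
      hu, hw, ZeroMemClass.coe_zero, map_zero, sub_zero, add_zero, zero_sub, h1, h2,
      Prod.snd_add, Prod.smul_snd, Prod.snd_zero, map_units_int_smul, LinearMap.smul_apply, hbr,
      smul_sub, smul_smul, ← uzpow_add]
    have e₁ : ∀ p r : ZMod 2, p * r + (r + 1) * (p + 1 + 1) = p := by decide
    have e₂ : ∀ p r : ZMod 2, p + 1 + (p + 1) * (r + 1) = (p + 1) * (r + 1 + 1) := by decide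
    rw [e₁, e₂, negOnePow_add_one_smul]
    abel

theorem listJacobiator_cons_cons (hK : A.IsSubalgebra K) (hV : A.IsAbelianSubalgebra V)
    (hVK : IsCompl V K) {D : L →ₗ[k] L} (hD : A.IsOddDerivation D) {u w : A.ConeLetter V}
    (hu : u.2.1.2 = 0) (hw : w.2.1.2 = 0) {l : List (A.ConeLetter V)}
    (hl : ∀ u ∈ l, u.2.1.1 = 0) : A.listJacobiator hVK D (u :: w :: l) = 0 := by
  by_cases hne : l = []
  · subst hne
    exact listJacobiator_pair hK hV hVK hD hu hw
  let ι := LinearMap.inr k L V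
  let P := V.projectionOnto K hVK
  let e : List (A.ConeLetter V) → List (A.ConeLetter V) → L × V := fun S T =>
    if S = [] then (-1 : ℤˣ) ^ (u.1 + 1) • ι (P (A.iterAd (A.vals T)
      (A.bracket u.2.1.1 w.2.1.1))) else 0
  have he : splitSum A.coneParity e l = (-1 : ℤˣ) ^ (u.1 + 1) • ι (P (A.iterAd (A.vals l)
      (A.bracket u.2.1.1 w.2.1.1))) := by
    rw [splitSum_nil_left _ e (by simp [e])]
    simp [e]
  -- With both ΠL-arguments inside, only the binary inner bracket survives, which gives `e`. With
  -- one inside, the two sums arise. With both outside, the outer bracket has three or more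
  -- arguments and vanishes.
  have key : A.listJacobiator hVK D (u :: w :: l) = splitSum A.coneParity e l +
      ((-1 : ℤˣ) ^ u.1 • splitSum A.coneParity (fun S T => ι (P (A.iterAd (A.vals T)
        (A.bracket u.2.1.1 (P (A.iterAd (A.vals S) w.2.1.1)))))) l +
      (-1 : ℤˣ) ^ (u.1 * w.1 + w.1) • splitSum A.coneParity (fun S T => ι (P (A.iterAd (A.vals T)
        (A.bracket w.2.1.1 (P (A.iterAd (A.vals S) u.2.1.1)))))) l) := by
    simp only [listJacobiator, splitSum_cons', ← splitSum_smul, ← splitSum_add]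
    refine splitSum_congr _ _ fun S T hST => ?_
    have hS : ∀ u ∈ S, u.2.1.1 = 0 := fun u hu => hl u (hST.subset (List.mem_append_left _ hu))
    have hT : ∀ u ∈ T, u.2.1.1 = 0 := fun u hu => hl u (hST.subset (List.mem_append_right _ hu))
    have hTne : S = [] → T ≠ [] := by
      rintro rfl rfl
      exact hne (by simpa using hST)
    have h1 : A.coneBracket hVK D (A.coneBracket hVK D (A.vals (u :: w :: S)) :: A.vals T) =
        e S T := by
      by_cases h0 : S = []
      · subst h0
        rw [vals_cons, vals_cons, vals_nil, coneBracket_pair hVK D hu hw,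
          coneBracket_cons hVK D _ (vals_ne_nil (hTne rfl)) (fst_eq_zero_of_mem_vals hT),
          A.gradingInvolution_apply u.fst_mem]
        simp only [ZeroMemClass.coe_zero, map_zero, add_zero, map_units_int_smul,
          LinearMap.smul_apply, e, if_true]
        rw [← map_units_int_smul ι]
        rfl
      · rw [vals_cons, vals_cons, coneBracket_cons_cons_eq_zero hVK D hu hw (vals_ne_nil h0),
          coneBracket_zero_cons]
        simp [e, h0]
    have h2 : ∀ {u w : A.ConeLetter V}, u.2.1.2 = 0 → w.2.1.2 = 0 →
        A.coneBracket hVK D (A.coneBracket hVK D (A.vals (u :: S)) :: A.vals (w :: T)) =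
        (-1 : ℤˣ) ^ ((u.1 + 1 + listParity A.coneParity S) * w.1) • ι (P (A.iterAd (A.vals T)
          (A.bracket w.2.1.1 (P (A.iterAd (A.vals S) u.2.1.1))))) := by
      intro u w hu hw
      rw [coneBracket_vals_cons_snd hVK D hu hS]
      refine coneBracket_cons_cons hV hVK D
        (projectionOnto_mem_deg hK hV hVK (iterAd_mem u.fst_mem S)) w hw ?_ hT
      by_cases h0 : S = []
      · exact Or.inr (hTne h0)
      · exact Or.inl (if_neg h0)
    have h3 : A.coneBracket hVK D (A.coneBracket hVK D (A.vals S) :: A.vals (u :: w :: T)) = 0 :=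
      coneBracket_cons_cons_cons_eq_zero hVK D hu hw _ _
    rw [h1, h2 hu hw, h2 hw hu, h3, smul_zero, add_zero, add_assoc]
    simp only [smul_smul, ← uzpow_add, listParity_cons]
    congr 4
    · generalize listParity A.coneParity S = s
      change u.1 * (w.1 + s) + (w.1 + 1 + s) * u.1 = u.1
      generalize u.1 = p
      generalize w.1 = r
      revert p r s; decide
    · generalize listParity A.coneParity S = s
      change w.1 * s + (u.1 + 1 + s) * w.1 = u.1 * w.1 + w.1
      generalize u.1 = p
      generalize w.1 = r
      revert p r s; decide
  have h := projectionOnto_iterAd_bracket hK hV hVK u.fst_mem w.fst_mem l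
  rw [key, he, ← map_splitSum ι, ← map_splitSum ι, ← map_units_int_smul ι, ← map_units_int_smul ι,
    ← map_units_int_smul ι, ← map_add, ← map_add]
  simp only [P]
  rw [h, smul_sub, smul_smul, ← uzpow_add, negOnePow_add_one_smul]
  have e : ∀ p r : ZMod 2, p + 1 + (p + 1) * (r + 1) = p * r + r := by decide
  rw [e, neg_sub_left, ← map_zero ι]
  congr 1
  abel

/-- Only the nested binary brackets survive, and their sum is the Jacobi identity of L. -/
theorem listJacobiator_triple (hVK : IsCompl V K) {D : L →ₗ[k] L}
    {u w z : A.ConeLetter V} (hu : u.2.1.2 = 0) (hw : w.2.1.2 = 0) (hz : z.2.1.2 = 0) :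
    A.listJacobiator hVK D [u, w, z] = 0 := by
  have h3 : ∀ {u v : L × V} (hu : u.2 = 0) (hv : v.2 = 0) (w : L × V) (l : List (L × V)), _ :=
    fun hu hv w l => coneBracket_cons_cons_cons_eq_zero (A := A) hVK D hu hv w l
  have h2 : ∀ u v w : A.ConeLetter V, u.2.1.2 = 0 → v.2.1.2 = 0 → w.2.1.2 = 0 →
      A.coneBracket hVK D [A.coneBracket hVK D [u.2.1, v.2.1], w.2.1] =
      LinearMap.inl k L V ((-1 : ℤˣ) ^ (v.1 + 1) •
        A.bracket (A.bracket u.2.1.1 v.2.1.1) w.2.1.1) := by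
    intro u v w hu hv hw
    rw [coneBracket_pair hVK D hu hv, coneBracket_pair hVK D rfl hw,
      A.gradingInvolution_apply u.fst_mem, map_units_int_smul, LinearMap.smul_apply,
      map_units_int_smul, A.gradingInvolution_apply (A.bracket_mem _ _ _ _ u.fst_mem v.fst_mem),
      smul_smul, ← uzpow_add, map_units_int_smul, LinearMap.smul_apply]
    have e : ∀ p r : ZMod 2, p + 1 + (p + 1 + (r + 1)) = r + 1 := by decide
    rw [e]
    rfl
  simp only [listJacobiator, splitSum_cons', splitSum_nil, vals_cons, vals_nil, h3 hw hz,
    h3 hu hz, h3 hu hw, h2 _ _ _ hu hw hz, h2 _ _ _ hu hz hw, h2 _ _ _ hw hz hu,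
    coneBracket_zero_cons, smul_zero, add_zero, zero_add]
  simp only [← map_units_int_smul (LinearMap.inl k L V), ← map_add, smul_smul, ← uzpow_add,
    listParity_cons, listParity_nil]
  rw [A.bracket_bracket u.fst_mem w.fst_mem z.fst_mem,
    A.bracket_skew (A.bracket_mem _ _ _ _ w.fst_mem z.fst_mem) u.fst_mem]
  simp only [smul_smul, ← uzpow_add, smul_add]
  have e₁ : ∀ p r t : ZMod 2,
    p * (r + (t + 0)) + (t + 1) + ((r + 1 + (t + 1)) * (p + 1) + 1) = r := by decide
  have e₂ : ∀ r t : ZMod 2, r * (t + 0) + (t + 1) = r * t + t + 1 := by decide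
  have e₃ : ∀ r t : ZMod 2, r + 1 + (r + 1) * (t + 1) = r * t + t := by decide
  rw [e₁, e₂, mul_zero, zero_add, e₃, negOnePow_add_one_smul, negOnePow_add_one_smul,
    ← map_zero (LinearMap.inl k L V)]
  congr 1
  abel

theorem listJacobiator_cons_cons_cons (hVK : IsCompl V K) {D : L →ₗ[k] L}
    {u w z : A.ConeLetter V} (hu : u.2.1.2 = 0) (hw : w.2.1.2 = 0) (hz : z.2.1.2 = 0)
    (l : List (A.ConeLetter V)) : A.listJacobiator hVK D (u :: w :: z :: l) = 0 := by
  by_cases hne : l = []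
  · subst hne
    exact listJacobiator_triple hVK hu hw hz
  simp only [listJacobiator, splitSum_cons']
  rw [← splitSum_zero A.coneParity l]
  refine splitSum_congr _ _ fun S T hST => ?_
  have h3 : ∀ {u v : L × V} (hu : u.2 = 0) (hv : v.2 = 0) (w : L × V) (l : List (L × V)), _ :=
    fun hu hv w l => coneBracket_cons_cons_cons_eq_zero (A := A) hVK D hu hv w l
  -- If `S` is nonempty, the inner bracket vanishes. If it is empty, the inner bracket lies in ΠL
  -- and `T` is nonempty, so the outer bracket has at least three arguments, two of them from ΠL.
  have h2 : ∀ {u v w : L × V}, u.2 = 0 → v.2 = 0 → w.2 = 0 →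
      A.coneBracket hVK D (A.coneBracket hVK D (u :: v :: A.vals S) :: w :: A.vals T) = 0 := by
    intro u v w hu hv hw
    by_cases h0 : S = []
    · subst h0
      have hT : T ≠ [] := by
        rintro rfl
        exact hne (by simpa using hST)
      rw [vals_nil, coneBracket_pair hVK D hu hv]
      exact coneBracket_cons_cons_eq_zero hVK D rfl hw (vals_ne_nil hT)
    · rw [coneBracket_cons_cons_eq_zero hVK D hu hv (vals_ne_nil h0), coneBracket_zero_cons]
  simp only [vals_cons, h3 hw hz, h3 hu hz, h3 hu hw, h2 hu hw hz, h2 hu hz hw, h2 hw hz hu,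
    coneBracket_zero_cons, smul_zero, add_zero]

/-- Graded symmetry allows the ΠL-letters to be collected in front; their number then selects the
case. -/
theorem listJacobiator_of_pure (hK : A.IsSubalgebra K) (hV : A.IsAbelianSubalgebra V)
    (hVK : IsCompl V K) {D : L →ₗ[k] L} (hD : A.IsOddDerivation D) (hDK : ∀ x ∈ K, D x ∈ K)
    (hD2 : ∀ x, D (D x) = 0) {l : List (A.ConeLetter V)}
    (hl : ∀ u ∈ l, u.2.1.1 = 0 ∨ u.2.1.2 = 0) : A.listJacobiator hVK D l = 0 := by
  classical
  rw [(swapSymm_listJacobiator hK hV hVK hD).eq_zero_iff_of_perm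
    (List.filter_append_perm (fun u : A.ConeLetter V => decide (u.2.1.2 = 0)) l).symm]
  have h1 : ∀ u ∈ l.filter (fun u => decide (u.2.1.2 = 0)), u.2.1.2 = 0 := fun u hu =>
    of_decide_eq_true (List.mem_filter.1 hu).2
  have h2 : ∀ u ∈ l.filter (fun u => !decide (u.2.1.2 = 0)), u.2.1.1 = 0 := fun u hu => by
    obtain ⟨hu, h⟩ := List.mem_filter.1 hu
    exact (hl u hu).resolve_right (by simpa using h)
  generalize l.filter (fun u => decide (u.2.1.2 = 0)) = xs at h1
  generalize l.filter (fun u => !decide (u.2.1.2 = 0)) = as at h2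
  match xs with
  | [] => exact listJacobiator_of_fst hK hV hVK hD hDK hD2 h2
  | [u] => exact listJacobiator_cons hK hV hVK hD hDK hD2 (h1 u (by simp)) h2
  | [u, w] => exact listJacobiator_cons_cons hK hV hVK hD (h1 u (by simp)) (h1 w (by simp)) h2
  | u :: w :: z :: xs => 
    exact listJacobiator_cons_cons_cons hVK (h1 u (by simp)) (h1 w (by simp)) (h1 z (by simp)) _

theorem listJacobiator_eq_zero (hK : A.IsSubalgebra K) (hV : A.IsAbelianSubalgebra V)
    (hVK : IsCompl V K) {D : L →ₗ[k] L} (hD : A.IsOddDerivation D) (hDK : ∀ x ∈ K, D x ∈ K)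
    (hD2 : ∀ x, D (D x) = 0) (l : List (A.ConeLetter V)) : A.listJacobiator hVK D l = 0 := by
  -- The letters are split one at a time into their ΠL- and V-components, of the same parity, and
  -- join the prefix `l'` of pure letters.
  suffices ∀ l' : List (A.ConeLetter V), (∀ u ∈ l', u.2.1.1 = 0 ∨ u.2.1.2 = 0) →
      A.listJacobiator hVK D (l' ++ l) = 0 from this [] (by simp)
  induction l with
  | nil =>
    intro l' hl'
    rw [List.append_nil]
    exact listJacobiator_of_pure hK hV hVK hD hDK hD2 hl'
  | cons u l ih =>
    intro l' hl'
    let b : A.ConeLetter V := ⟨u.1, (u.2.1.1, 0), u.2.2.1, zero_mem _⟩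
    let c : A.ConeLetter V := ⟨u.1, (0, u.2.1.2), zero_mem _, u.2.2.2⟩
    have hu : u.2.1 = b.2.1 + c.2.1 := by simp [b, c]
    have hlin := fun S T => (isLinearMap_coneBracket (A := A) hVK D S T).map_add
    have h := splitSum_letter_add A.coneParity (a := u) (b := b) (c := c) rfl rfl
      (fun S T => A.coneBracket hVK D (A.coneBracket hVK D (A.vals S) :: A.vals T))
      (fun S T R => by
        simp only [vals_append, vals_cons, hu, hlin]
        exact hlin [] _ _ _)
      (fun S T R => by
        simp only [vals_append, vals_cons, hu]
        exact hlin (_ :: _) _ _ _) l' l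
    refine h.trans ?_
    have hb := ih (l' ++ [b]) (by
      intro v hv
      rcases List.mem_append.1 hv with hv | hv
      · exact hl' v hv
      · rw [List.mem_singleton.1 hv]
        exact Or.inr rfl)
    have hc := ih (l' ++ [c]) (by
      intro v hv
      rcases List.mem_append.1 hv with hv | hv
      · exact hl' v hv
      · rw [List.mem_singleton.1 hv]
        exact Or.inl rfl)
    rw [List.append_assoc, List.singleton_append] at hb hc
    exact (congrArg₂ (· + ·) hb hc).trans (add_zero _)

theorem isLInfinityAlgebra_coneBrackets (hK : A.IsSubalgebra K) (hV : A.IsAbelianSubalgebra V)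
    (hVK : IsCompl V K) {D : L →ₗ[k] L} (hD : A.IsOddDerivation D) (hDK : ∀ x ∈ K, D x ∈ K)
    (hD2 : ∀ x, D (D x) = 0) :
    IsLInfinityAlgebra (A.coneDeg V) (A.coneBrackets hVK D) where
  isInternal := isInternal_coneDeg hV
  odd n p a ha := by
    have h := coneBracket_mem hK hV hVK hD
      (List.ofFn fun i => (⟨p i, a i, ha i⟩ : A.ConeLetter V))
    rw [vals, listParity, List.map_ofFn, List.map_ofFn, List.sum_ofFn] at h
    exact h
  symm := (isConeBrackets_coneBrackets hV hVK hD).symm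
  jacobi n p a ha := by
    rw [jacobiator_coneBrackets hVK D ha, listJacobiator_eq_zero hK hV hVK hD hDK hD2]

end LieSuperalgebra

theorem theorem2 {k L : Type*} [Field k] [AddCommGroup L] [Module k L]
    (A : LieSuperalgebra k L) (K V : Submodule k L)
    (hK : A.IsSubalgebra K) (hV : A.IsAbelianSubalgebra V) (hVK : IsCompl V K)
    (D : L →ₗ[k] L) (hD : A.IsOddDerivation D)
    (hDK : ∀ x ∈ K, D x ∈ K) (hD2 : ∀ x, D (D x) = 0) :
    (∃! B : (n : ℕ) → MultilinearMap k (fun _ : Fin n => L × V) (L × V),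
      A.IsConeBrackets hVK D B) ∧
    ∀ B : (n : ℕ) → MultilinearMap k (fun _ : Fin n => L × V) (L × V),
      A.IsConeBrackets hVK D B → IsLInfinityAlgebra (A.coneDeg V) B := by
  have h := A.isConeBrackets_coneBrackets hV hVK hD
  refine ⟨⟨_, h, fun B hB => hB.unique hV h⟩, fun B hB => ?_⟩
  rw [hB.unique hV h]
  exact LieSuperalgebra.isLInfinityAlgebra_coneBrackets hK hV hVK hD hDK hD2
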